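/- Let $n\ge 1$ and let $\theta:[0,\infty)\to(0,\infty)$ be a decreasing (i.e. non-increasing) function with $\theta(t)\to0$ as $t\to\infty$ and $\int_1^\infty \theta(t)\,t^{-1}\,dt<\infty$. For functions $f,g$ on $\mathbb C^n$ let $$f\times g(z)=\int_{\mathbb C^n} f(z-w)\,g(w)\,e^{\frac i2\operatorname{Im}(z\cdot\bar w)}\,dw$$ be their twisted convolution, where $z\cdot\bar w=\sum_j z_j\bar w_j$ and $dw$ is Lebesgue measure, and for $k\in\mathbb N=\{0,1,2,\dots\}$ let $\varphi_k^{n-1}(z)=L_k^{n-1}\big(\tfrac12|z|^2\big)e^{-\frac14|z|^2}$, where $L_k^{n-1}$ is the Laguerre polynomial of degree $k$ and type $n-1$. For $\delta>0$ put $\theta_\delta(t)=\delta\,\theta(\delta t)$, $t\ge 0$; this function is again positive, decreasing, vanishes at infinity and satisfies $\int_1^\infty\theta_\delta(t)\,t^{-1}\,dt<\infty$. Then for each $\delta>0$ there is a radial function $g_\delta\in L^1(\mathbb C^n)$ whose (closed) support is contained in the ball $B(0,\delta)=\{z:|z|<\delta\}$, such that (i) for every $f\in L^1(\mathbb C^n)$,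 $f\times g_\delta\to f$ in $L^1(\mathbb C^n)$ as $\delta\to0^+$; (ii) for every $\delta>0$ there is a constant $C>0$ such that $$\|g_\delta\times\varphi_k^{n-1}\|_2\le C\,e^{-\sqrt{2k+n}\;\theta_\delta(\sqrt{2k+n})}\qquad\text{for all }k\in\mathbb N .$$ -/

import Mathlib

open MeasureTheory Filter Topology

/-- The Hermitian pairing `z · w̄ = ∑ⱼ zⱼ w̄ⱼ` on `ℂⁿ`. -/
noncomputable def hermitianDot {n : ℕ} (z w : EuclideanSpace ℂ (Fin n)) : ℂ :=
  ∑ j, z j * (starRingEnd ℂ) (w j)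

/-- Twisted convolution `(f × g)(z) = ∫ f(z - w) g(w) e^{(i/2) Im (z · w̄)} dw` on `ℂⁿ`, with
respect to Lebesgue measure on `ℂⁿ = ℝ²ⁿ`. -/
noncomputable def twistedConv {n : ℕ} (f g : EuclideanSpace ℂ (Fin n) → ℂ) :
    EuclideanSpace ℂ (Fin n) → ℂ :=
  fun z => ∫ w, f (z - w) * g w * Complex.exp (Complex.I / 2 * ((hermitianDot z w).im : ℂ))

/-- The Laguerre polynomial of type `a` and degree `k`,
`L_k^a(t) = ∑_{j = 0}^{k} (-1)^j (k + a choose k - j) t^j / j!`. -/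
noncomputable def laguerrePoly (a k : ℕ) (t : ℝ) : ℝ :=
  ∑ j ∈ Finset.range (k + 1),
    (-1 : ℝ) ^ j * ((k + a).choose (k - j) : ℝ) * t ^ j / (j.factorial : ℝ)

/-- The Laguerre function `φ_k^{n-1}(z) = L_k^{n-1}(|z|² / 2) e^{-|z|² / 4}` on `ℂⁿ`, `n ≥ 1`. -/
noncomputable def laguerreFun (n k : ℕ) (z : EuclideanSpace ℂ (Fin n)) : ℂ :=
  ((laguerrePoly (n - 1) k (‖z‖ ^ 2 / 2) * Real.exp (-(‖z‖ ^ 2 / 4)) : ℝ) : ℂ)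

/-- `θ` is a positive decreasing function on `[0, ∞)`, vanishing at infinity, with
`∫₁^∞ θ(t) t⁻¹ dt < ∞`. -/
structure IsInghamWeight (θ : ℝ → ℝ) : Prop where
  pos : ∀ t, 0 ≤ t → 0 < θ t
  antitoneOn : AntitoneOn θ (Set.Ici 0)
  tendsto_zero : Tendsto θ atTop (𝓝 0)
  integrableOn : IntegrableOn (fun t => θ t * t⁻¹) (Set.Ioi 1)

/-- A function on `ℂⁿ` is radial if it depends only on `|z|`. -/
def IsRadial {n : ℕ} (g : EuclideanSpace ℂ (Fin n) → ℂ) : Prop :=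
  ∀ z w, ‖z‖ = ‖w‖ → g z = g w

/-!
The Laguerre function `φ_k` is an eigenfunction of the twisted Laplacian with eigenvalue `2k + n`,
and integration by parts moves the twisted Laplacian `L` from `φ_k` to `g` in `g × φ_k`. Hence
`g × φ_k = (2k + n)^{-m} (L^m g) × φ_k` for every `m`, and Young's inequality bounds its `L²` norm
once the sup norm of `L^m g` is under control.

As in the Denjoy–Carleman theorem, `g` is the radial function `ψ(|z|²)`, where `ψ` is a bump
function averaged infinitely often: `2 m_q` times over intervals of length comparable to `2^{-q}`,
with `m_q ≈ 2^q η(2^q) + n q`. This makes `‖L^{m_q} g‖_∞ ≤ (ε 4^q)^{m_q}` for large `q`. Such an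
infinite average has compact support because `∑ m_q / 2^q < ∞`, that is `∑ η(2^q) < ∞`, which is
the condition `∫₁^∞ η(t) t⁻¹ dt < ∞`. For `2^q ≤ t < 2^{q+1}`, `t² = 2k + n` and `ε = e⁻²`, the
choice `m = m_q` gives the factor `e^{-2 m_q} ≤ e^{-t η(t) - n q}`, whose part `e^{-n q}` absorbs
the polynomial growth of `‖φ_k‖₂`. Dividing by `∫ g` turns the functions with shrinking supports
into an approximate identity.
-/

/-! ### Integration by parts for the twisted convolution -/

section TwistedLaplacian

variable {n : ℕ}

/-- The symplectic form `Im (z · w̄)` on `ℂⁿ`, bundled as a continuous real bilinear form. As a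
formula it is `⟪z, I w⟫` for the real inner product. -/
noncomputable def symp :
    EuclideanSpace ℂ (Fin n) →L[ℝ] EuclideanSpace ℂ (Fin n) →L[ℝ] ℝ :=
  (innerSL ℝ).bilinearComp (.id ℝ _) (Complex.I • .id ℝ _)

theorem symp_eq_sum (z w : EuclideanSpace ℂ (Fin n)) :
    symp z w = ∑ j, ((z j).im * (w j).re - (z j).re * (w j).im) := by
  change inner ℝ z (Complex.I • w) = _
  rw [PiLp.inner_apply]
  refine Finset.sum_congr rfl fun j _ => ?_
  simp only [PiLp.smul_apply, smul_eq_mul, Complex.inner, Complex.mul_re, Complex.mul_im,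
    Complex.I_re, Complex.I_im, Complex.conj_re, Complex.conj_im]
  ring

theorem symp_eq_im_hermitianDot (z w : EuclideanSpace ℂ (Fin n)) :
    symp z w = (hermitianDot z w).im := by
  rw [symp_eq_sum, hermitianDot, Complex.im_sum]
  refine Finset.sum_congr rfl fun j _ => ?_
  rw [Complex.mul_im, Complex.conj_re, Complex.conj_im]
  ring

theorem symp_self (z : EuclideanSpace ℂ (Fin n)) : symp z z = 0 := by
  rw [symp_eq_sum]
  exact Finset.sum_eq_zero fun j _ => by ring

theorem symp_swap (z w : EuclideanSpace ℂ (Fin n)) : symp z w = -symp w z := by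
  rw [symp_eq_sum, symp_eq_sum, ← Finset.sum_neg_distrib]
  exact Finset.sum_congr rfl fun j _ => by ring

/-- The unimodular factor `e^{(i/2) Im (z · w̄)}` in the integrand of the twisted convolution. -/
noncomputable def twistFactor (z w : EuclideanSpace ℂ (Fin n)) : ℂ :=
  Complex.exp (Complex.I / 2 * (symp z w : ℂ))

theorem twistedConv_apply (f g : EuclideanSpace ℂ (Fin n) → ℂ) (z : EuclideanSpace ℂ (Fin n)) :
    twistedConv f g z = ∫ w, f (z - w) * g w * twistFactor z w := by
  simp only [twistedConv, twistFactor, symp_eq_im_hermitianDot]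

theorem norm_twistFactor (z w : EuclideanSpace ℂ (Fin n)) : ‖twistFactor z w‖ = 1 := by
  have h_arg : Complex.I / 2 * (symp z w : ℂ) = ((symp z w / 2 : ℝ) : ℂ) * Complex.I := by
    push_cast
    ring
  rw [twistFactor, h_arg, Complex.norm_exp_ofReal_mul_I]

@[fun_prop]
theorem continuous_twistFactor {X : Type*} [TopologicalSpace X]
    {f g : X → EuclideanSpace ℂ (Fin n)} (hf : Continuous f) (hg : Continuous g) :
    Continuous fun x => twistFactor (f x) (g x) := by
  unfold twistFactor
  fun_prop

theorem hasFDerivAt_twistFactor (z w : EuclideanSpace ℂ (Fin n)) :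
    HasFDerivAt (twistFactor z)
      (twistFactor z w • (Complex.I / 2) • Complex.ofRealCLM.comp (symp z)) w :=
  ((Complex.ofRealCLM.comp (symp z)).hasFDerivAt.const_mul (Complex.I / 2)).cexp

theorem integrable_twistedConv_integrand {G φ : EuclideanSpace ℂ (Fin n) → ℂ}
    (hGs : HasCompactSupport G) (hG : Continuous G) (hφ : Continuous φ)
    (z : EuclideanSpace ℂ (Fin n)) :
    Integrable fun w => G (z - w) * φ w * twistFactor z w := by
  have h_supp : HasCompactSupport fun w => G (z - w) := hGs.comp_homeomorph (Homeomorph.subLeft z)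
  exact Continuous.integrable_of_hasCompactSupport (by fun_prop) h_supp.mul_right.mul_right

/-- The twisted derivative `∂_v + κ Im (v · w̄)`. The two values of interest are `κ = ± i/2`, which
correspond to the left- and right-invariant vector fields of the Heisenberg group. -/
noncomputable def twistedDeriv (κ : ℂ) (v : EuclideanSpace ℂ (Fin n))
    (G : EuclideanSpace ℂ (Fin n) → ℂ) (w : EuclideanSpace ℂ (Fin n)) : ℂ :=
  fderiv ℝ G w v + κ * (symp v w : ℂ) * G w

theorem contDiff_twistedDeriv {G : EuclideanSpace ℂ (Fin n) → ℂ} {m : ℕ}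
    (hG : ContDiff ℝ (m + 1) G) (κ : ℂ) (v : EuclideanSpace ℂ (Fin n)) :
    ContDiff ℝ m (twistedDeriv κ v G) := by
  have h_symp : ContDiff ℝ m fun w => (symp v w : ℂ) :=
    (Complex.ofRealCLM.comp (symp v)).contDiff
  exact ((hG.fderiv_right le_rfl).clm_apply contDiff_const).add
    ((contDiff_const.mul h_symp).mul (hG.of_le (by norm_cast; omega)))

theorem hasCompactSupport_twistedDeriv {G : EuclideanSpace ℂ (Fin n) → ℂ}
    (hG : HasCompactSupport G) (κ : ℂ) (v : EuclideanSpace ℂ (Fin n)) :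
    HasCompactSupport (twistedDeriv κ v G) :=
  (hG.fderiv_apply ℝ v).add hG.mul_left

theorem hasFDerivAt_comp_const_sub {E F : Type*} [NormedAddCommGroup E] [NormedSpace ℝ E]
    [NormedAddCommGroup F] [NormedSpace ℝ F] {G : E → F} {z w : E}
    (hG : DifferentiableAt ℝ G (z - w)) :
    HasFDerivAt (fun x => G (z - x)) (-fderiv ℝ G (z - w)) w := by
  simpa [Function.comp_def] using hG.hasFDerivAt.comp w ((hasFDerivAt_id w).const_sub z)

theorem hasFDerivAt_twistedKernel {G : EuclideanSpace ℂ (Fin n) → ℂ}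
    (hG : Differentiable ℝ G) (z w : EuclideanSpace ℂ (Fin n)) :
    HasFDerivAt (fun w => G (z - w) * twistFactor z w)
      (G (z - w) • twistFactor z w • (Complex.I / 2) • Complex.ofRealCLM.comp (symp z) +
        twistFactor z w • -fderiv ℝ G (z - w)) w :=
  (hasFDerivAt_comp_const_sub (hG (z - w))).fun_mul (hasFDerivAt_twistFactor z w)

theorem fderiv_twistedKernel_apply {G : EuclideanSpace ℂ (Fin n) → ℂ}
    (hG : Differentiable ℝ G) (z w v : EuclideanSpace ℂ (Fin n)) :
    fderiv ℝ (fun w => G (z - w) * twistFactor z w) w v =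
      (Complex.I / 2 * (symp z v : ℂ) * G (z - w) - fderiv ℝ G (z - w) v) * twistFactor z w := by
  rw [(hasFDerivAt_twistedKernel hG z w).fderiv]
  simp only [add_apply, neg_apply, smul_apply, ContinuousLinearMap.comp_apply,
    Complex.ofRealCLM_apply, smul_eq_mul]
  ring

theorem twistedConv_twistedDeriv {G φ : EuclideanSpace ℂ (Fin n) → ℂ} (hGs : HasCompactSupport G)
    (hG : ContDiff ℝ 1 G) (hφ : ContDiff ℝ 1 φ) (v : EuclideanSpace ℂ (Fin n)) :
    twistedConv G (twistedDeriv (-(Complex.I / 2)) v φ) =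
      twistedConv (twistedDeriv (Complex.I / 2) v G) φ := by
  funext z
  have hG_diff : Differentiable ℝ G := hG.differentiable one_ne_zero
  have hφ' : Continuous fun w => fderiv ℝ φ w v := (hφ.continuous_fderiv one_ne_zero).clm_apply
    continuous_const
  have hG' : Continuous fun w => fderiv ℝ G w v := (hG.continuous_fderiv one_ne_zero).clm_apply
    continuous_const
  have h_left := integrable_twistedConv_integrand hGs hG.continuous
    (contDiff_twistedDeriv (m := 0) hφ (-(Complex.I / 2)) v).continuous z
  have h_right := integrable_twistedConv_integrand (hasCompactSupport_twistedDeriv hGs _ v)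
    (contDiff_twistedDeriv (m := 0) hG (Complex.I / 2) v).continuous hφ.continuous z
  have h_kernel_φ' : Integrable fun w => G (z - w) * twistFactor z w * fderiv ℝ φ w v := by
    simpa only [mul_right_comm] using integrable_twistedConv_integrand hGs hG.continuous hφ' z
  have h_kernel'_φ : Integrable fun w =>
      fderiv ℝ (fun w => G (z - w) * twistFactor z w) w v * φ w := by
    simp only [fderiv_twistedKernel_apply hG_diff, mul_right_comm _ (twistFactor z _) (φ _)]
    exact integrable_twistedConv_integrand
      (G := fun w => Complex.I / 2 * (symp z v : ℂ) * G w - fderiv ℝ G w v)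
      (hGs.mul_left.sub (hGs.fderiv_apply ℝ v)) ((continuous_const.mul hG.continuous).sub hG')
      hφ.continuous z
  have h_kernel_φ : Integrable fun w => G (z - w) * twistFactor z w * φ w := by
    simpa only [mul_right_comm] using
      integrable_twistedConv_integrand hGs hG.continuous hφ.continuous z
  have h_parts := integral_mul_fderiv_eq_neg_fderiv_mul_of_integrable h_kernel'_φ h_kernel_φ'
    h_kernel_φ (fun w _ => (hasFDerivAt_twistedKernel hG_diff z w).differentiableAt)
    (fun w _ => hφ.differentiable one_ne_zero w)
  rw [twistedConv_apply, twistedConv_apply, ← sub_eq_zero, ← integral_sub h_left h_right]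
  trans ∫ w, (G (z - w) * twistFactor z w * fderiv ℝ φ w v +
    fderiv ℝ (fun w => G (z - w) * twistFactor z w) w v * φ w)
  · congr 1
    funext w
    rw [fderiv_twistedKernel_apply hG_diff, twistedDeriv, twistedDeriv, map_sub, symp_swap z v]
    push_cast
    ring
  · rw [integral_add h_kernel_φ' h_kernel'_φ, h_parts, neg_add_cancel]

/-- The twisted Laplacian `-∑ⱼ (D_{eⱼ}² + D_{i eⱼ}²)`, where `D_v = ∂_v + κ Im (v · w̄)`. On radial
functions and for `κ = ± i/2` it is the Hermite-type operator `-Δ + |z|²/4`. -/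
noncomputable def twistedLaplacian (κ : ℂ) (G : EuclideanSpace ℂ (Fin n) → ℂ)
    (w : EuclideanSpace ℂ (Fin n)) : ℂ :=
  -∑ j, ∑ c ∈ {1, Complex.I},
    twistedDeriv κ (EuclideanSpace.single j c) (twistedDeriv κ (EuclideanSpace.single j c) G) w

theorem twistedConv_twistedLaplacian {G φ : EuclideanSpace ℂ (Fin n) → ℂ}
    (hGs : HasCompactSupport G) (hG : ContDiff ℝ 2 G) (hφ : ContDiff ℝ 2 φ) :
    twistedConv G (twistedLaplacian (-(Complex.I / 2)) φ) =
      twistedConv (twistedLaplacian (Complex.I / 2) G) φ := by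
  have h_swap (v : EuclideanSpace ℂ (Fin n)) :
      twistedConv G (twistedDeriv (-(Complex.I / 2)) v (twistedDeriv (-(Complex.I / 2)) v φ)) =
        twistedConv (twistedDeriv (Complex.I / 2) v (twistedDeriv (Complex.I / 2) v G)) φ := by
    rw [twistedConv_twistedDeriv hGs (hG.of_le one_le_two) (contDiff_twistedDeriv (m := 1) hφ _ v),
      twistedConv_twistedDeriv (hasCompactSupport_twistedDeriv hGs _ v)
        (contDiff_twistedDeriv (m := 1) hG _ v) (hφ.of_le one_le_two)]
  funext z
  have h_left (v : EuclideanSpace ℂ (Fin n)) := integrable_twistedConv_integrand hGs hG.continuous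
    (contDiff_twistedDeriv (m := 0) (contDiff_twistedDeriv (m := 1) hφ (-(Complex.I / 2)) v)
      (-(Complex.I / 2)) v).continuous z
  have h_right (v : EuclideanSpace ℂ (Fin n)) := integrable_twistedConv_integrand
    (hasCompactSupport_twistedDeriv (hasCompactSupport_twistedDeriv hGs (Complex.I / 2) v) _ v)
    (contDiff_twistedDeriv (m := 0) (contDiff_twistedDeriv (m := 1) hG (Complex.I / 2) v)
      (Complex.I / 2) v).continuous hφ.continuous z
  simp only [twistedConv_apply, twistedLaplacian, mul_neg, neg_mul, Finset.mul_sum, Finset.sum_mul,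
    integral_neg]
  rw [integral_finsetSum _ fun j _ => integrable_finsetSum _ fun c _ => h_left _,
    integral_finsetSum _ fun j _ => integrable_finsetSum _ fun c _ => h_right _]
  refine congrArg Neg.neg (Finset.sum_congr rfl fun j _ => ?_)
  rw [integral_finsetSum _ fun c _ => h_left _, integral_finsetSum _ fun c _ => h_right _]
  refine Finset.sum_congr rfl fun c _ => ?_
  simpa only [twistedConv_apply] using congrFun (h_swap (EuclideanSpace.single j c)) z

end TwistedLaplacian

/-! ### The twisted Laplacian on radial functions -/

section Radial

variable {n : ℕ}

/-- The radial function `z ↦ f (|z|²)` on `ℂⁿ` with real profile `f`. Using `|z|²` rather than `|z|`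
as the variable makes it smooth as soon as `f` is. -/
noncomputable def sqRadial (n : ℕ) (f : ℝ → ℝ) (z : EuclideanSpace ℂ (Fin n)) : ℂ :=
  (f (‖z‖ ^ 2) : ℂ)

/-- The operator on profiles that the twisted Laplacian induces through `f ↦ f (|z|²)`. -/
noncomputable def radialTwistedLaplacian (n : ℕ) (f : ℝ → ℝ) (s : ℝ) : ℝ :=
  -4 * s * deriv (deriv f) s - 4 * n * deriv f s + s / 4 * f s

theorem isRadial_sqRadial (f : ℝ → ℝ) : IsRadial (sqRadial n f) :=
  fun z w h => by rw [sqRadial, sqRadial, h]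

@[fun_prop]
theorem continuous_sqRadial {f : ℝ → ℝ} (hf : Continuous f) : Continuous (sqRadial n f) := by
  unfold sqRadial
  fun_prop

theorem contDiff_sqRadial {f : ℝ → ℝ} {m : WithTop ℕ∞} (hf : ContDiff ℝ m f) :
    ContDiff ℝ m (sqRadial n f) :=
  Complex.ofRealCLM.contDiff.comp (hf.comp (contDiff_norm_sq ℝ))

theorem tsupport_sqRadial_subset {f : ℝ → ℝ} {R : ℝ} (hf : ∀ s, R < s → f s = 0) :
    tsupport (sqRadial n f) ⊆ Metric.closedBall 0 √R := by
  refine closure_minimal (fun z hz => ?_) Metric.isClosed_closedBall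
  contrapose! hz
  have h_norm : √R < ‖z‖ := by simpa using hz
  simp [sqRadial, hf _ (Real.lt_sq_of_sqrt_lt h_norm)]

theorem hasCompactSupport_sqRadial {f : ℝ → ℝ} {R : ℝ} (hf : ∀ s, R < s → f s = 0) :
    HasCompactSupport (sqRadial n f) :=
  (isCompact_closedBall 0 √R).of_isClosed_subset (isClosed_tsupport _)
    (tsupport_sqRadial_subset hf)

theorem hasFDerivAt_sqRadial {f : ℝ → ℝ} (hf : Differentiable ℝ f)
    (w : EuclideanSpace ℂ (Fin n)) :
    HasFDerivAt (sqRadial n f)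
      ((2 * sqRadial n (deriv f) w) • Complex.ofRealCLM.comp (innerSL ℝ w)) w := by
  have h := Complex.ofRealCLM.hasFDerivAt.comp w
    ((hf (‖w‖ ^ 2)).hasDerivAt.comp_hasFDerivAt w (hasStrictFDerivAt_norm_sq w).hasFDerivAt)
  refine h.congr_fderiv ?_
  ext v
  simp only [ContinuousLinearMap.comp_smulₛₗ, Real.ringHom_apply, ContinuousLinearMap.comp_smul,
    smul_apply, ContinuousLinearMap.comp_apply, coe_innerSL_apply, Complex.ofRealCLM_apply,
    nsmul_eq_mul, Nat.cast_ofNat, Complex.real_smul, sqRadial, smul_eq_mul]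
  ring

theorem twistedDeriv_sqRadial {f : ℝ → ℝ} (hf : Differentiable ℝ f) (κ : ℂ)
    (v : EuclideanSpace ℂ (Fin n)) :
    twistedDeriv κ v (sqRadial n f) = fun w =>
      2 * (inner ℝ v w : ℂ) * sqRadial n (deriv f) w + κ * (symp v w : ℂ) * sqRadial n f w := by
  funext w
  rw [twistedDeriv, (hasFDerivAt_sqRadial hf w).fderiv]
  simp only [smul_apply, ContinuousLinearMap.comp_apply, coe_innerSL_apply, real_inner_comm v w,
    Complex.ofRealCLM_apply, smul_eq_mul]
  ring

theorem twistedDeriv_twistedDeriv_sqRadial {f : ℝ → ℝ} (hf : Differentiable ℝ f)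
    (hf' : Differentiable ℝ (deriv f)) (κ : ℂ) (v w : EuclideanSpace ℂ (Fin n)) :
    twistedDeriv κ v (twistedDeriv κ v (sqRadial n f)) w =
      2 * (‖v‖ ^ 2 : ℝ) * sqRadial n (deriv f) w +
        4 * (inner ℝ v w : ℂ) ^ 2 * sqRadial n (deriv (deriv f)) w +
        4 * κ * (symp v w : ℂ) * (inner ℝ v w : ℂ) * sqRadial n (deriv f) w +
        κ ^ 2 * (symp v w : ℂ) ^ 2 * sqRadial n f w := by
  have h_inner : HasFDerivAt (fun w => (inner ℝ v w : ℂ))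
      (Complex.ofRealCLM.comp (innerSL ℝ v)) w :=
    (Complex.ofRealCLM.comp (innerSL ℝ v)).hasFDerivAt
  have h_symp : HasFDerivAt (fun w => (symp v w : ℂ)) (Complex.ofRealCLM.comp (symp v)) w :=
    (Complex.ofRealCLM.comp (symp v)).hasFDerivAt
  have h := ((h_inner.const_mul 2).fun_mul (hasFDerivAt_sqRadial hf' w)).fun_add
    ((h_symp.const_mul κ).fun_mul (hasFDerivAt_sqRadial hf w))
  rw [twistedDeriv_sqRadial hf, twistedDeriv, h.fderiv]
  simp only [add_apply, smul_apply, ContinuousLinearMap.comp_apply, coe_innerSL_apply,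
    real_inner_comm v w, real_inner_self_eq_norm_sq, Complex.ofRealCLM_apply, smul_eq_mul,
    symp_self, Complex.ofReal_zero]
  ring

theorem inner_single_left (j : Fin n) (c : ℂ) (w : EuclideanSpace ℂ (Fin n)) :
    inner ℝ (EuclideanSpace.single j c) w = c.re * (w j).re + c.im * (w j).im := by
  rw [PiLp.inner_apply, Finset.sum_eq_single j]
  · simp [Complex.inner, mul_comm]
  · intro i _ hi
    simp [hi]
  · simp

theorem symp_single_left (j : Fin n) (c : ℂ) (w : EuclideanSpace ℂ (Fin n)) :
    symp (EuclideanSpace.single j c) w = c.im * (w j).re - c.re * (w j).im := by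
  rw [symp_eq_sum, Finset.sum_eq_single j]
  · simp
  · intro i _ hi
    simp [hi]
  · simp

theorem twistedLaplacian_sqRadial {f : ℝ → ℝ} (hf : Differentiable ℝ f)
    (hf' : Differentiable ℝ (deriv f)) {κ : ℂ} (hκ : κ ^ 2 = -1 / 4) :
    twistedLaplacian κ (sqRadial n f) = sqRadial n (radialTwistedLaplacian n f) := by
  funext w
  have h_coord (j : Fin n) : ∑ c ∈ {1, Complex.I},
      twistedDeriv κ (EuclideanSpace.single j c)
        (twistedDeriv κ (EuclideanSpace.single j c) (sqRadial n f)) w =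
      4 * sqRadial n (deriv f) w + ((‖w j‖ ^ 2 : ℝ) : ℂ) *
        (4 * sqRadial n (deriv (deriv f)) w - 1 / 4 * sqRadial n f w) := by
    rw [Finset.sum_pair (by simp [Complex.ext_iff])]
    simp only [twistedDeriv_twistedDeriv_sqRadial hf hf', inner_single_left, symp_single_left,
      PiLp.norm_single, norm_one, Complex.norm_I, Complex.one_re, Complex.one_im,
      Complex.I_re, Complex.I_im, Complex.sq_norm, Complex.normSq_apply]
    push_cast
    linear_combination ((w j).re ^ 2 + (w j).im ^ 2 : ℂ) * sqRadial n f w * hκ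
  rw [twistedLaplacian, Finset.sum_congr rfl fun j _ => h_coord j, Finset.sum_add_distrib,
    ← Finset.sum_mul _ fun j => ((‖w j‖ ^ 2 : ℝ) : ℂ), ← Complex.ofReal_sum,
    ← EuclideanSpace.norm_sq_eq, Finset.sum_const, Finset.card_univ, Fintype.card_fin]
  simp only [nsmul_eq_mul, sqRadial, radialTwistedLaplacian]
  push_cast
  ring

theorem twistedConv_radialTwistedLaplacian {f g : ℝ → ℝ} {R : ℝ} (hf : ContDiff ℝ 2 f)
    (hg : ContDiff ℝ 2 g) (hgs : ∀ s, R < s → g s = 0) :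
    twistedConv (sqRadial n g) (sqRadial n (radialTwistedLaplacian n f)) =
      twistedConv (sqRadial n (radialTwistedLaplacian n g)) (sqRadial n f) := by
  have hκ : (Complex.I / 2) ^ 2 = -1 / 4 := by
    rw [div_pow, Complex.I_sq]
    norm_num
  rw [← twistedLaplacian_sqRadial (hf.differentiable two_ne_zero)
      ((ContDiff.deriv' hf).differentiable one_ne_zero) ((neg_sq _).trans hκ),
    ← twistedLaplacian_sqRadial (hg.differentiable two_ne_zero)
      ((ContDiff.deriv' hg).differentiable one_ne_zero) hκ]
  exact twistedConv_twistedLaplacian (hasCompactSupport_sqRadial hgs) (contDiff_sqRadial hg)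
    (contDiff_sqRadial hf)

end Radial

/-! ### Laguerre functions -/

section Laguerre

open Polynomial

/-- The coefficient of `t ^ j` in the Laguerre polynomial `L_k^a`, written so that it vanishes for
`k < j`. -/
noncomputable def laguerreCoeff (a k j : ℕ) : ℝ :=
  (-1) ^ j * k.choose j * ((k + a).factorial / (k.factorial * (a + j).factorial))

theorem laguerreCoeff_succ (a k j : ℕ) :
    ((j : ℝ) + 1) * (j + a + 1) * laguerreCoeff a k (j + 1) = (j - k) * laguerreCoeff a k j := by
  have h_choose : (k.choose (j + 1) * (j + 1) : ℝ) = k.choose j * (k - j) := by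
    rcases le_or_gt j k with hj | hj
    · rw [← Nat.cast_sub hj]
      exact_mod_cast Nat.choose_succ_right_eq k j
    · simp [Nat.choose_eq_zero_of_lt hj, Nat.choose_eq_zero_of_lt (hj.trans j.lt_succ_self)]
  have h_factorial : ((a + (j + 1)).factorial : ℝ) = (j + a + 1) * (a + j).factorial := by
    rw [← add_assoc, Nat.factorial_succ]
    push_cast
    ring
  have h_ne : (j : ℝ) + a + 1 ≠ 0 := by positivity
  have := Nat.factorial_ne_zero (a + j)
  simp only [laguerreCoeff, h_factorial]
  field_simp
  linear_combination (-1 : ℝ) ^ (j + 1) * h_choose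

theorem laguerreCoeff_eq {a k j : ℕ} (hj : j ≤ k) :
    laguerreCoeff a k j = (-1) ^ j * (k + a).choose (k - j) / j.factorial := by
  rw [laguerreCoeff, Nat.cast_choose ℝ hj, Nat.cast_choose ℝ (by omega : k - j ≤ k + a),
    show k + a - (k - j) = a + j by omega]
  have := Nat.factorial_ne_zero k
  field_simp

/-- The Laguerre polynomial `L_k^a` as a formal polynomial. -/
noncomputable def laguerrePolynomial (a k : ℕ) : ℝ[X] :=
  ∑ j ∈ Finset.range (k + 1), C (laguerreCoeff a k j) * X ^ j

theorem coeff_laguerrePolynomial (a k j : ℕ) :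
    (laguerrePolynomial a k).coeff j = laguerreCoeff a k j := by
  simp only [laguerrePolynomial, finsetSum_coeff, coeff_C_mul_X_pow, Finset.sum_ite_eq]
  refine ite_eq_left_iff.2 fun hj => ?_
  rw [laguerreCoeff, Nat.choose_eq_zero_of_lt (by simpa using hj)]
  simp

theorem laguerrePoly_eq_sum (a k : ℕ) (t : ℝ) :
    laguerrePoly a k t = ∑ j ∈ Finset.range (k + 1), laguerreCoeff a k j * t ^ j :=
  Finset.sum_congr rfl fun j hj => by
    rw [laguerreCoeff_eq (Finset.mem_range_succ_iff.1 hj), div_mul_eq_mul_div]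

theorem eval_laguerrePolynomial (a k : ℕ) (t : ℝ) :
    (laguerrePolynomial a k).eval t = laguerrePoly a k t := by
  rw [laguerrePoly_eq_sum, laguerrePolynomial, eval_finsetSum]
  simp only [eval_C_mul, eval_X_pow]

theorem laguerrePolynomial_ode (a k : ℕ) :
    X * derivative (derivative (laguerrePolynomial a k)) +
      (C ((a : ℝ) + 1) - X) * derivative (laguerrePolynomial a k) +
      C (k : ℝ) * laguerrePolynomial a k = 0 := by
  ext j
  have h_rec := laguerreCoeff_succ a k j
  rw [sub_mul]
  rcases j with _ | j <;>
  · simp only [coeff_add, coeff_sub, coeff_C_mul, coeff_derivative, coeff_zero, coeff_X_mul_zero,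
      coeff_X_mul, coeff_laguerrePolynomial]
    push_cast at h_rec ⊢
    linear_combination h_rec

/-- The profile of the Laguerre function `φ_k^{n-1}` in the variable `s = |z|²`. -/
noncomputable def laguerreProfile (n k : ℕ) (s : ℝ) : ℝ :=
  laguerrePoly (n - 1) k (s / 2) * Real.exp (-(s / 4))

theorem laguerreFun_eq_sqRadial (n k : ℕ) :
    laguerreFun n k = sqRadial n (laguerreProfile n k) := rfl

theorem contDiff_laguerreProfile (n k : ℕ) {m : WithTop ℕ∞} :
    ContDiff ℝ m (laguerreProfile n k) := by
  unfold laguerreProfile laguerrePoly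
  fun_prop

theorem continuous_laguerreFun (n k : ℕ) : Continuous (laguerreFun n k) :=
  continuous_sqRadial (contDiff_laguerreProfile n k (m := 0)).continuous

theorem deriv_eval_mul_exp (p : ℝ[X]) :
    deriv (fun s => p.eval (s / 2) * Real.exp (-(s / 4))) = fun s =>
      (C (1 / 2) * derivative p - C (1 / 4) * p).eval (s / 2) * Real.exp (-(s / 4)) := by
  funext s
  have h_eval : HasDerivAt (fun s : ℝ => p.eval (s / 2))
      ((derivative p).eval (s / 2) * (1 / 2)) s :=
    (p.hasDerivAt (s / 2)).comp (h := fun s => s / 2) s ((hasDerivAt_id' s).div_const 2)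
  have h_exp : HasDerivAt (fun s : ℝ => Real.exp (-(s / 4)))
      (Real.exp (-(s / 4)) * (-(1 / 4))) s :=
    ((hasDerivAt_id s).div_const 4).neg.exp
  rw [(h_eval.fun_mul h_exp).deriv]
  simp only [eval_sub, eval_C_mul]
  ring

theorem radialTwistedLaplacian_laguerreProfile {n : ℕ} (hn : 1 ≤ n) (k : ℕ) (s : ℝ) :
    radialTwistedLaplacian n (laguerreProfile n k) s = (2 * k + n) * laguerreProfile n k s := by
  obtain ⟨a, rfl⟩ := Nat.exists_eq_add_of_le' hn
  have h_profile : laguerreProfile (a + 1) k =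
      fun s => (laguerrePolynomial a k).eval (s / 2) * Real.exp (-(s / 4)) := by
    funext s
    rw [eval_laguerrePolynomial]
    rfl
  have h_ode := congrArg (eval (s / 2)) (laguerrePolynomial_ode a k)
  simp only [radialTwistedLaplacian, h_profile, deriv_eval_mul_exp, map_sub,
    derivative_mul, derivative_C] at h_ode ⊢
  simp only [eval_add, eval_sub, eval_mul, eval_C, eval_X, eval_zero] at h_ode ⊢
  push_cast
  linear_combination (-2 * Real.exp (-(s / 4))) * h_ode

theorem laguerreCoeff_mul_factorial (a k i : ℕ) :
    laguerreCoeff a k i * (i + a).factorial =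
      (-1) ^ i * k.choose i * ((k + a).factorial / k.factorial) := by
  rw [laguerreCoeff, add_comm a i]
  have := Nat.factorial_ne_zero (i + a)
  field_simp

theorem sum_neg_one_pow_mul_choose_mul_eval {P : ℝ[X]} (hP : P.Monic) {k : ℕ}
    (hk : P.natDegree ≤ k) :
    ∑ i ∈ Finset.range (k + 1), (-1) ^ i * (k.choose i : ℝ) * P.eval (i : ℝ) =
      if P.natDegree = k then (-1) ^ k * (k.factorial : ℝ) else 0 := by
  have h_diff : (fwdDiff (1 : ℝ))^[k] P.eval 0 =
      if P.natDegree = k then (k.factorial : ℝ) else 0 := by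
    split_ifs with h
    · rw [← h, fwdDiff_iter_degree_eq_factorial, hP.leadingCoeff, one_smul]
      rfl
    · rw [fwdDiff_iter_eq_zero_of_degree_lt (lt_of_le_of_ne hk h), Pi.zero_apply]
  rw [fwdDiff_iter_eq_sum_shift] at h_diff
  rw [← mul_zero ((-1 : ℝ) ^ k), ← mul_ite, ← h_diff, Finset.mul_sum]
  refine Finset.sum_congr rfl fun i hi => ?_
  have h_sign : (-1 : ℝ) ^ k * (-1) ^ (k - i) = (-1) ^ i := by
    have h_sum : k + (k - i) = i + 2 * (k - i) := by have := Finset.mem_range_succ_iff.1 hi; omega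
    rw [← pow_add, h_sum, pow_add, pow_mul, neg_one_sq, one_pow, mul_one]
  simp only [zsmul_eq_mul, zero_add, nsmul_eq_mul, mul_one]
  push_cast
  rw [← h_sign]
  ring

/-- Against a power of degree at most `k` the Laguerre coefficients act as a `k`-th forward
difference, because `(i + j + a)! / (i + a)!` is a monic polynomial of degree `j` in `i`. -/
theorem sum_laguerreCoeff_mul_factorial (a : ℕ) {k j : ℕ} (hj : j ≤ k) :
    ∑ i ∈ Finset.range (k + 1), laguerreCoeff a k i * (i + (j + a)).factorial =
      if j = k then (-1) ^ k * ((k + a).factorial : ℝ) else 0 := by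
  set P : ℝ[X] := (ascPochhammer ℝ j).comp (X + C ((a : ℝ) + 1)) with hP
  have h_monic : P.Monic := (monic_ascPochhammer ℝ j).comp_X_add_C _
  have h_deg : P.natDegree = j := by
    rw [hP, natDegree_comp, ascPochhammer_natDegree, natDegree_X_add_C, mul_one]
  have h_factorial (i : ℕ) :
      ((i + (j + a)).factorial : ℝ) = (i + a).factorial * P.eval (i : ℝ) := by
    rw [show i + (j + a) = i + a + j by omega, ← factorial_mul_ascPochhammer, hP, eval_comp]
    simp only [eval_add, eval_X, eval_C]
    push_cast
    ring_nf
  simp only [h_factorial, ← mul_assoc, laguerreCoeff_mul_factorial, mul_right_comm _ (_ / _ : ℝ)]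
  rw [← Finset.sum_mul, sum_neg_one_pow_mul_choose_mul_eval h_monic (h_deg.trans_le hj), h_deg,
    ite_mul, zero_mul, mul_assoc, mul_div_cancel₀ _ (Nat.cast_ne_zero.2 k.factorial_ne_zero)]

theorem integrableOn_pow_mul_exp_neg (m : ℕ) :
    IntegrableOn (fun x : ℝ => x ^ m * Real.exp (-x)) (Set.Ioi 0) := by
  simpa [mul_comm] using Real.GammaIntegral_convergent m.cast_add_one_pos

theorem integral_pow_mul_exp_neg (m : ℕ) :
    ∫ x in Set.Ioi (0 : ℝ), x ^ m * Real.exp (-x) = m.factorial := by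
  rw [← Real.Gamma_nat_eq_factorial, Real.Gamma_eq_integral m.cast_add_one_pos]
  simp [mul_comm]

theorem laguerrePoly_mul_pow_eq_sum (a k m : ℕ) (x : ℝ) :
    laguerrePoly a k x * (x ^ m * Real.exp (-x)) =
      ∑ i ∈ Finset.range (k + 1), laguerreCoeff a k i * (x ^ (i + m) * Real.exp (-x)) := by
  rw [laguerrePoly_eq_sum, Finset.sum_mul]
  exact Finset.sum_congr rfl fun i _ => by ring

theorem integral_laguerrePoly_mul_pow (a : ℕ) {k j : ℕ} (hj : j ≤ k) :
    ∫ x in Set.Ioi (0 : ℝ), laguerrePoly a k x * (x ^ (j + a) * Real.exp (-x)) =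
      if j = k then (-1) ^ k * ((k + a).factorial : ℝ) else 0 := by
  simp only [laguerrePoly_mul_pow_eq_sum]
  rw [integral_finsetSum _ fun i _ => (integrableOn_pow_mul_exp_neg _).const_mul _]
  simp only [integral_const_mul, integral_pow_mul_exp_neg]
  exact sum_laguerreCoeff_mul_factorial a hj

theorem integrableOn_laguerrePoly_mul_pow (a k m : ℕ) :
    IntegrableOn (fun x => laguerrePoly a k x * (x ^ m * Real.exp (-x))) (Set.Ioi 0) := by
  simp only [laguerrePoly_mul_pow_eq_sum]
  exact integrable_finsetSum _ fun i _ => (integrableOn_pow_mul_exp_neg _).const_mul _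

theorem integral_laguerrePoly_sq_mul_pow (a k : ℕ) :
    ∫ x in Set.Ioi (0 : ℝ), laguerrePoly a k x ^ 2 * (x ^ a * Real.exp (-x)) =
      (k + a).factorial / k.factorial := by
  have h_expand (x : ℝ) : laguerrePoly a k x ^ 2 * (x ^ a * Real.exp (-x)) =
      ∑ j ∈ Finset.range (k + 1),
        laguerreCoeff a k j * (laguerrePoly a k x * (x ^ (j + a) * Real.exp (-x))) := by
    rw [sq]
    nth_rw 1 [laguerrePoly_eq_sum]
    rw [Finset.sum_mul, Finset.sum_mul]
    exact Finset.sum_congr rfl fun j _ => by ring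
  simp only [h_expand]
  rw [integral_finsetSum _ fun j _ => (integrableOn_laguerrePoly_mul_pow a k _).const_mul _]
  simp only [integral_const_mul]
  rw [Finset.sum_congr rfl fun j hj => by
    rw [integral_laguerrePoly_mul_pow a (Finset.mem_range_succ_iff.1 hj)]]
  simp only [mul_ite, mul_zero, Finset.sum_ite_eq', Finset.self_mem_range_succ, if_true]
  rw [mul_left_comm, add_comm k a, add_comm a k, laguerreCoeff_mul_factorial, ← mul_assoc,
    ← mul_assoc, ← pow_add, ← two_mul, pow_mul, neg_one_sq, one_pow, Nat.choose_self]
  simp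

theorem finrank_real_euclideanSpace_complex (n : ℕ) :
    Module.finrank ℝ (EuclideanSpace ℂ (Fin n)) = 2 * n := by
  rw [← Module.finrank_mul_finrank ℝ ℂ (EuclideanSpace ℂ (Fin n))]
  simp

theorem integral_comp_norm_sq {n : ℕ} (hn : 1 ≤ n) (f : ℝ → ℝ) :
    ∫ z : EuclideanSpace ℂ (Fin n), f (‖z‖ ^ 2) =
      n * volume.real (Metric.ball (0 : EuclideanSpace ℂ (Fin n)) 1) *
        ∫ s in Set.Ioi 0, s ^ (n - 1) * f s := by
  have h_finrank := finrank_real_euclideanSpace_complex n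
  have : Nontrivial (EuclideanSpace ℂ (Fin n)) :=
    Module.nontrivial_of_finrank_pos (R := ℝ) (by omega)
  rw [integral_fun_norm_addHaar volume fun r => f (r ^ 2), h_finrank,
    ← integral_comp_rpow_Ioi_of_pos (g := fun s => s ^ (n - 1) * f s) two_pos]
  have h_subst : ∫ x in Set.Ioi (0 : ℝ), (2 * x ^ ((2 : ℝ) - 1)) •
        ((x ^ (2 : ℝ)) ^ (n - 1) * f (x ^ (2 : ℝ))) =
      ∫ r in Set.Ioi (0 : ℝ), 2 * (r ^ (2 * n - 1) • f (r ^ 2)) := by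
    refine integral_congr_ae (ae_of_all _ fun r => ?_)
    have h_exp : 2 * n - 1 = 1 + 2 * (n - 1) := by omega
    simp only [Real.rpow_two, smul_eq_mul, h_exp, pow_add, pow_mul, pow_one,
      show (2 : ℝ) - 1 = 1 by norm_num, Real.rpow_one]
    ring
  rw [h_subst, integral_const_mul, nsmul_eq_mul, smul_eq_mul]
  push_cast
  ring

theorem integral_norm_laguerreFun_sq {n : ℕ} (hn : 1 ≤ n) (k : ℕ) :
    ∫ z, ‖laguerreFun n k z‖ ^ 2 =
      n * volume.real (Metric.ball (0 : EuclideanSpace ℂ (Fin n)) 1) * 2 ^ n *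
        ((k + (n - 1)).factorial / k.factorial) := by
  have h_scale := integral_comp_mul_left_Ioi
    (fun s => s ^ (n - 1) * laguerreProfile n k s ^ 2) 0 (two_pos (α := ℝ))
  have h_profile (x : ℝ) : (2 * x) ^ (n - 1) * laguerreProfile n k (2 * x) ^ 2 =
      2 ^ (n - 1) * (laguerrePoly (n - 1) k x ^ 2 * (x ^ (n - 1) * Real.exp (-x))) := by
    rw [laguerreProfile, mul_pow, mul_pow, mul_div_cancel_left₀ x two_ne_zero, ← Real.exp_nat_mul]
    ring_nf
  simp only [h_profile, integral_const_mul, integral_laguerrePoly_sq_mul_pow, mul_zero,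
    smul_eq_mul] at h_scale
  have h_norm (z : EuclideanSpace ℂ (Fin n)) :
      ‖laguerreFun n k z‖ ^ 2 = laguerreProfile n k (‖z‖ ^ 2) ^ 2 := by
    rw [laguerreFun_eq_sqRadial, sqRadial, Complex.norm_real, Real.norm_eq_abs, sq_abs]
  obtain ⟨a, rfl⟩ := Nat.exists_eq_add_of_le' hn
  simp only [h_norm, integral_comp_norm_sq hn fun s => laguerreProfile (a + 1) k s ^ 2]
  rw [eq_inv_mul_iff_mul_eq₀ two_ne_zero] at h_scale
  rw [← h_scale, pow_succ]
  simp only [Nat.add_sub_cancel]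
  ring

theorem factorial_add_div_factorial_le_pow (k a : ℕ) :
    ((k + a).factorial / k.factorial : ℝ) ≤ (k + a) ^ a := by
  rw [div_le_iff₀' (by positivity), ← Nat.factorial_mul_ascFactorial]
  push_cast
  gcongr
  exact_mod_cast (Nat.ascFactorial_le_pow_add k a)

theorem eLpNorm_two_eq_sqrt_integral {α E : Type*} [MeasurableSpace α] {μ : Measure α}
    [NormedAddCommGroup E] {f : α → E} (hf : AEStronglyMeasurable f μ)
    (hf_sq : Integrable (fun x => ‖f x‖ ^ 2) μ) :
    eLpNorm f 2 μ = ENNReal.ofReal √(∫ x, ‖f x‖ ^ 2 ∂μ) := by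
  rw [((memLp_two_iff_integrable_sq_norm hf).2 hf_sq).eLpNorm_eq_integral_rpow_norm
    two_ne_zero ENNReal.ofNat_ne_top, Real.sqrt_eq_rpow]
  simp

theorem exists_eLpNorm_laguerreFun_le {n : ℕ} (hn : 1 ≤ n) :
    ∃ C : ℝ, 0 < C ∧ ∀ k : ℕ, eLpNorm (laguerreFun n k) 2 volume ≤
      ENNReal.ofReal (C * √(2 * (k : ℝ) + n) ^ n) := by
  set K : ℝ := n * volume.real (Metric.ball (0 : EuclideanSpace ℂ (Fin n)) 1) * 2 ^ n with hK_def
  have hK : 0 < K := by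
    have : 0 < volume.real (Metric.ball (0 : EuclideanSpace ℂ (Fin n)) 1) :=
      ENNReal.toReal_pos (Metric.measure_ball_pos _ _ one_pos).ne' measure_ball_lt_top.ne
    positivity
  refine ⟨√K, Real.sqrt_pos.2 hK, fun k => ?_⟩
  have h_integral := integral_norm_laguerreFun_sq hn k
  have h_integrable : Integrable fun z => ‖laguerreFun n k z‖ ^ 2 :=
    .of_integral_ne_zero (by rw [h_integral]; positivity)
  have h_freq : 1 ≤ 2 * (k : ℝ) + n := by
    have : (1 : ℝ) ≤ n := by exact_mod_cast hn
    linarith [k.cast_nonneg (α := ℝ)]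
  have h_ratio : ((k + (n - 1)).factorial / k.factorial : ℝ) ≤ (2 * (k : ℝ) + n) ^ n :=
    calc ((k + (n - 1)).factorial / k.factorial : ℝ) ≤ (k + (n - 1 : ℕ)) ^ (n - 1) :=
          factorial_add_div_factorial_le_pow k (n - 1)
      _ ≤ (2 * (k : ℝ) + n) ^ (n - 1) := by
          gcongr
          · linarith [k.cast_nonneg (α := ℝ)]
          · exact Nat.sub_le n 1
      _ ≤ (2 * (k : ℝ) + n) ^ n := pow_le_pow_right₀ h_freq (Nat.sub_le n 1)
  rw [eLpNorm_two_eq_sqrt_integral (continuous_laguerreFun n k).aestronglyMeasurable h_integrable,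
    h_integral, ← hK_def]
  refine ENNReal.ofReal_le_ofReal ?_
  calc √(K * ((k + (n - 1)).factorial / k.factorial)) ≤ √(K * (2 * (k : ℝ) + n) ^ n) := by gcongr
    _ = √K * √(2 * (k : ℝ) + n) ^ n := by
        have h_sqrt_pow : √((2 * (k : ℝ) + n) ^ n) = √(2 * (k : ℝ) + n) ^ n := by
          rw [Real.sqrt_eq_iff_eq_sq (by positivity) (by positivity), pow_right_comm,
            Real.sq_sqrt (by positivity)]
        rw [Real.sqrt_mul hK.le, h_sqrt_pow]

end Laguerre

/-! ### Decay of twisted convolutions with Laguerre functions -/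

section Decay

open scoped ENNReal ContDiff

variable {n : ℕ}

theorem contDiff_radialTwistedLaplacian {f : ℝ → ℝ} (hf : ContDiff ℝ ∞ f) :
    ContDiff ℝ ∞ (radialTwistedLaplacian n f) := by
  have hf' : ContDiff ℝ ∞ (deriv f) := (contDiff_infty_iff_deriv.1 hf).2
  have : ContDiff ℝ ∞ (deriv (deriv f)) := (contDiff_infty_iff_deriv.1 hf').2
  unfold radialTwistedLaplacian
  fun_prop

theorem contDiff_iterate_radialTwistedLaplacian {f : ℝ → ℝ} (hf : ContDiff ℝ ∞ f) (m : ℕ) :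
    ContDiff ℝ ∞ ((radialTwistedLaplacian n)^[m] f) :=
  Function.Iterate.rec (ContDiff ℝ ∞) hf (fun _ => contDiff_radialTwistedLaplacian) m

theorem eqOn_zero_radialTwistedLaplacian {f : ℝ → ℝ} {U : Set ℝ} (hU : IsOpen U)
    (hf : Set.EqOn f 0 U) : Set.EqOn (radialTwistedLaplacian n f) 0 U := by
  have h_deriv : Set.EqOn (deriv f) 0 U := by simpa only [deriv_zero] using hf.deriv hU
  have h_deriv_deriv : Set.EqOn (deriv (deriv f)) 0 U := by
    simpa only [deriv_zero] using h_deriv.deriv hU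
  intro s hs
  rw [radialTwistedLaplacian, h_deriv_deriv hs, h_deriv hs, hf hs]
  simp only [Pi.zero_apply, mul_zero, sub_zero, add_zero]

theorem eqOn_zero_iterate_radialTwistedLaplacian {f : ℝ → ℝ} {U : Set ℝ} (hU : IsOpen U)
    (hf : Set.EqOn f 0 U) (m : ℕ) : Set.EqOn ((radialTwistedLaplacian n)^[m] f) 0 U :=
  Function.Iterate.rec (fun f : ℝ → ℝ => Set.EqOn f 0 U) hf
    (fun _ => eqOn_zero_radialTwistedLaplacian hU) m

theorem twistedConv_const_smul_right (f g : EuclideanSpace ℂ (Fin n) → ℂ) (c : ℂ) :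
    twistedConv f (c • g) = c • twistedConv f g := by
  funext z
  simp only [twistedConv_apply, Pi.smul_apply, smul_eq_mul, ← integral_const_mul]
  congr 1
  funext w
  ring

theorem twistedConv_radialTwistedLaplacian_laguerreFun (hn : 1 ≤ n) {g : ℝ → ℝ} {R : ℝ}
    (hg : ContDiff ℝ 2 g) (hgs : ∀ s, R < s → g s = 0) (k : ℕ) :
    twistedConv (sqRadial n (radialTwistedLaplacian n g)) (laguerreFun n k) =
      (2 * k + n : ℂ) • twistedConv (sqRadial n g) (laguerreFun n k) := by
  have h_eigen : sqRadial n (radialTwistedLaplacian n (laguerreProfile n k)) =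
      (2 * k + n : ℂ) • laguerreFun n k := by
    funext z
    rw [laguerreFun_eq_sqRadial, Pi.smul_apply, smul_eq_mul, sqRadial, sqRadial,
      radialTwistedLaplacian_laguerreProfile hn]
    push_cast
    rfl
  rw [laguerreFun_eq_sqRadial,
    ← twistedConv_radialTwistedLaplacian (contDiff_laguerreProfile n k) hg hgs, h_eigen,
    twistedConv_const_smul_right, laguerreFun_eq_sqRadial]

theorem twistedConv_iterate_radialTwistedLaplacian_laguerreFun (hn : 1 ≤ n) {g : ℝ → ℝ} {R : ℝ}
    (hg : ContDiff ℝ ∞ g) (hgs : ∀ s, R < s → g s = 0) (k m : ℕ) :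
    twistedConv (sqRadial n ((radialTwistedLaplacian n)^[m] g)) (laguerreFun n k) =
      (2 * k + n : ℂ) ^ m • twistedConv (sqRadial n g) (laguerreFun n k) := by
  induction m with
  | zero => rw [Function.iterate_zero_apply, pow_zero, one_smul]
  | succ m ih =>
    have h_smooth : ContDiff ℝ 2 ((radialTwistedLaplacian n)^[m] g) :=
      contDiff_infty.1 (contDiff_iterate_radialTwistedLaplacian hg m) 2
    have h_supp : Set.EqOn ((radialTwistedLaplacian n)^[m] g) 0 (Set.Ioi R) :=
      eqOn_zero_iterate_radialTwistedLaplacian isOpen_Ioi hgs m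
    rw [Function.iterate_succ_apply',
      twistedConv_radialTwistedLaplacian_laguerreFun hn h_smooth h_supp, ih, smul_smul, pow_succ']

theorem lintegral_mul_rpow_le {α : Type*} [MeasurableSpace α] {μ : Measure α} {p q : ℝ}
    (hpq : p.HolderConjugate q) {F H : α → ℝ≥0∞} (hF : AEMeasurable F μ) (hH : AEMeasurable H μ) :
    (∫⁻ x, F x * H x ∂μ) ^ p ≤ (∫⁻ x, F x ∂μ) ^ (p / q) * ∫⁻ x, F x * H x ^ p ∂μ := by
  have h_split (x : α) : F x ^ (1 / q) * (F x ^ (1 / p) * H x) = F x * H x := by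
    rw [← mul_assoc, ← ENNReal.rpow_add_of_nonneg _ _ hpq.symm.one_div_nonneg hpq.one_div_nonneg,
      add_comm, one_div, one_div, hpq.inv_add_inv_eq_one, ENNReal.rpow_one]
  have h_holder := ENNReal.lintegral_mul_le_Lp_mul_Lq μ hpq.symm (f := fun x => F x ^ (1 / q))
    (g := fun x => F x ^ (1 / p) * H x) (by fun_prop) (by fun_prop)
  simp only [Pi.mul_apply, h_split, ENNReal.mul_rpow_of_nonneg _ _ hpq.nonneg, ← ENNReal.rpow_mul,
    one_div_mul_cancel hpq.ne_zero, one_div_mul_cancel hpq.symm.ne_zero, ENNReal.rpow_one]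
    at h_holder
  calc (∫⁻ x, F x * H x ∂μ) ^ p
      ≤ ((∫⁻ x, F x ∂μ) ^ (1 / q) * (∫⁻ x, F x * H x ^ p ∂μ) ^ (1 / p)) ^ p :=
        ENNReal.rpow_le_rpow h_holder hpq.nonneg
    _ = (∫⁻ x, F x ∂μ) ^ (p / q) * ∫⁻ x, F x * H x ^ p ∂μ := by
        rw [ENNReal.mul_rpow_of_nonneg _ _ hpq.nonneg, ← ENNReal.rpow_mul, ← ENNReal.rpow_mul,
          one_div_mul_cancel hpq.ne_zero, ENNReal.rpow_one, one_div_mul_eq_div]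

theorem enorm_twistFactor (z w : EuclideanSpace ℂ (Fin n)) : ‖twistFactor z w‖ₑ = 1 := by
  rw [← ofReal_norm, norm_twistFactor, ENNReal.ofReal_one]

theorem enorm_twistedConv_le (f h : EuclideanSpace ℂ (Fin n) → ℂ) (z : EuclideanSpace ℂ (Fin n)) :
    ‖twistedConv f h z‖ₑ ≤ ∫⁻ w, ‖f w‖ₑ * ‖h (z - w)‖ₑ := by
  rw [twistedConv_apply, ← lintegral_sub_left_eq_self _ z]
  refine (enorm_integral_le_lintegral_enorm _).trans_eq ?_
  simp only [enorm_mul, enorm_twistFactor, mul_one, sub_sub_cancel]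

theorem eLpNorm_twistedConv_le {p q : ℝ} (hpq : p.HolderConjugate q)
    {f h : EuclideanSpace ℂ (Fin n) → ℂ} (hf : Measurable f) (hh : Measurable h) :
    eLpNorm (twistedConv f h) (ENNReal.ofReal p) volume ≤
      eLpNorm f 1 volume * eLpNorm h (ENNReal.ofReal p) volume := by
  have h_pointwise (z : EuclideanSpace ℂ (Fin n)) : ‖twistedConv f h z‖ₑ ^ p ≤
      (∫⁻ w, ‖f w‖ₑ) ^ (p / q) * ∫⁻ w, ‖f w‖ₑ * ‖h (z - w)‖ₑ ^ p :=
    (ENNReal.rpow_le_rpow (enorm_twistedConv_le f h z) hpq.nonneg).trans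
      (lintegral_mul_rpow_le hpq (by fun_prop) (by fun_prop))
  have h_translate (w : EuclideanSpace ℂ (Fin n)) :
      ∫⁻ z, ‖f w‖ₑ * ‖h (z - w)‖ₑ ^ p = ‖f w‖ₑ * ∫⁻ z, ‖h z‖ₑ ^ p := by
    rw [lintegral_const_mul _ (by fun_prop),
      lintegral_sub_right_eq_self (fun z => ‖h z‖ₑ ^ p) w]
  have h_exponent : p / q + 1 = p := by
    rw [hpq.div_conj_eq_sub_one, sub_add_cancel]
  have h_p : ENNReal.ofReal p ≠ 0 := (ENNReal.ofReal_pos.2 hpq.pos).ne'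
  rw [eLpNorm_one_eq_lintegral_enorm,
    eLpNorm_eq_lintegral_rpow_enorm_toReal h_p ENNReal.ofReal_ne_top,
    eLpNorm_eq_lintegral_rpow_enorm_toReal h_p ENNReal.ofReal_ne_top,
    ENNReal.toReal_ofReal hpq.nonneg]
  calc (∫⁻ z, ‖twistedConv f h z‖ₑ ^ p) ^ (1 / p)
      ≤ (∫⁻ z, (∫⁻ w, ‖f w‖ₑ) ^ (p / q) * ∫⁻ w, ‖f w‖ₑ * ‖h (z - w)‖ₑ ^ p) ^ (1 / p) :=
        ENNReal.rpow_le_rpow (lintegral_mono h_pointwise) hpq.one_div_nonneg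
    _ = ((∫⁻ w, ‖f w‖ₑ) ^ p * ∫⁻ z, ‖h z‖ₑ ^ p) ^ (1 / p) := by
        rw [lintegral_const_mul _ (by fun_prop), lintegral_lintegral_swap (by fun_prop)]
        simp only [h_translate]
        rw [lintegral_mul_const _ (by fun_prop), ← mul_assoc]
        nth_rw 2 [← ENNReal.rpow_one (∫⁻ w, ‖f w‖ₑ)]
        rw [← ENNReal.rpow_add_of_nonneg _ _ (div_nonneg hpq.nonneg hpq.symm.nonneg) zero_le_one,
          h_exponent]
    _ = (∫⁻ w, ‖f w‖ₑ) * (∫⁻ z, ‖h z‖ₑ ^ p) ^ (1 / p) := by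
        rw [ENNReal.mul_rpow_of_nonneg _ _ hpq.one_div_nonneg, ← ENNReal.rpow_mul,
          mul_one_div_cancel hpq.ne_zero, ENNReal.rpow_one]

theorem eLpNorm_one_sqRadial_le {f : ℝ → ℝ} {R B : ℝ} (hfs : ∀ s, R < s → f s = 0)
    (hfB : ∀ s, |f s| ≤ B) :
    eLpNorm (sqRadial n f) 1 volume ≤ ENNReal.ofReal
      (B * volume.real (Metric.closedBall (0 : EuclideanSpace ℂ (Fin n)) √R)) := by
  have h_norm (z : EuclideanSpace ℂ (Fin n)) : ‖sqRadial n f z‖ ≤ B := by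
    rw [sqRadial, Complex.norm_real]
    exact hfB _
  rw [← eLpNorm_restrict_eq_of_support_subset
    ((subset_tsupport _).trans (tsupport_sqRadial_subset hfs))]
  refine (eLpNorm_le_of_ae_bound (ae_of_all _ h_norm)).trans_eq ?_
  rw [Measure.restrict_apply_univ, ENNReal.toReal_one, inv_one, ENNReal.rpow_one,
    ENNReal.ofReal_mul' measureReal_nonneg, ofReal_measureReal measure_closedBall_lt_top.ne,
    mul_comm]

theorem eLpNorm_twistedConv_sqRadial_laguerreFun_le (hn : 1 ≤ n) {g : ℝ → ℝ} {R B : ℝ} {m : ℕ}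
    (hg : ContDiff ℝ ∞ g) (hgs : ∀ s, R < s → g s = 0)
    (hgB : ∀ s, |(radialTwistedLaplacian n)^[m] g s| ≤ B) (k : ℕ) :
    eLpNorm (twistedConv (sqRadial n g) (laguerreFun n k)) 2 volume ≤ ENNReal.ofReal
      (B * volume.real (Metric.closedBall (0 : EuclideanSpace ℂ (Fin n)) √R) /
        (2 * (k : ℝ) + n) ^ m) * eLpNorm (laguerreFun n k) 2 volume := by
  have h_freq : (0 : ℝ) < (2 * (k : ℝ) + n) ^ m := by positivity
  have h_iterate := twistedConv_iterate_radialTwistedLaplacian_laguerreFun hn hg hgs k m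
  have h_freq_enorm : ‖(2 * k + n : ℂ) ^ m‖ₑ = ENNReal.ofReal ((2 * (k : ℝ) + n) ^ m) := by
    rw [← ofReal_norm]
    norm_cast
  have h_cont : Continuous (sqRadial n ((radialTwistedLaplacian n)^[m] g)) :=
    continuous_sqRadial (contDiff_iterate_radialTwistedLaplacian hg m).continuous
  have h_young := eLpNorm_twistedConv_le Real.HolderConjugate.two_two h_cont.measurable
    (continuous_laguerreFun n k).measurable
  rw [h_iterate, eLpNorm_const_smul, h_freq_enorm, ENNReal.ofReal_ofNat] at h_young
  rw [ENNReal.ofReal_div_of_pos h_freq, ENNReal.div_eq_inv_mul, mul_assoc,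
    ← ENNReal.mul_le_iff_le_inv (ENNReal.ofReal_pos.2 h_freq).ne' ENNReal.ofReal_ne_top]
  refine h_young.trans ?_
  gcongr
  exact eLpNorm_one_sqRadial_le
    (eqOn_zero_iterate_radialTwistedLaplacian isOpen_Ioi hgs m : Set.EqOn _ _ (Set.Ioi R)) hgB

end Decay

/-! ### Approximate identities for the twisted convolution -/

section ApproximateIdentity

open scoped ENNReal

theorem tendsto_eLpNorm_translate_sub {E F : Type*} [NormedAddCommGroup E] [NormedSpace ℝ E]
    [FiniteDimensional ℝ E] [MeasurableSpace E] [BorelSpace E] {μ : Measure E}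
    [μ.IsAddHaarMeasure] [NormedAddCommGroup F] {p : ℝ≥0∞} [Fact (1 ≤ p)] (hp : p ≠ ∞)
    {f : E → F} (hf : MemLp f p μ) :
    Tendsto (fun w => eLpNorm (fun z => f (z - w) - f z) p μ) (𝓝 0) (𝓝 0) := by
  have : ProperSpace E := FiniteDimensional.proper_real E
  let subRight : C(E, C(E, E)) := ContinuousMap.curry ⟨fun p => p.2 - p.1, by fun_prop⟩
  have h_preserving (w : E) : MeasurePreserving (subRight w) μ μ := measurePreserving_sub_right μ w
  have h := Filter.Tendsto.compMeasurePreservingLp (tendsto_const_nhds (x := hf.toLp f))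
    (subRight.continuous.tendsto 0) h_preserving (h_preserving 0) hp
  simp only [tendsto_iff_edist_tendsto_0, Lp.toLp_compMeasurePreserving,
    Lp.edist_toLp_toLp] at h
  simpa [subRight, Pi.sub_def, Function.comp_def] using h

variable {n : ℕ}

theorem twistFactor_zero_right (z : EuclideanSpace ℂ (Fin n)) : twistFactor z 0 = 1 := by
  rw [twistFactor, map_zero, Complex.ofReal_zero, mul_zero, Complex.exp_zero]

theorem twistFactor_sub_self_left (z w : EuclideanSpace ℂ (Fin n)) :
    twistFactor (z - w) w = twistFactor z w := by
  rw [twistFactor, twistFactor, map_sub, sub_apply, symp_self, sub_zero]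

theorem enorm_twistFactor_sub_one_le (z w : EuclideanSpace ℂ (Fin n)) :
    ‖twistFactor z w - 1‖ₑ ≤ 2 :=
  enorm_sub_le.trans_eq (by rw [enorm_twistFactor, enorm_one, one_add_one_eq_two])

theorem tendsto_lintegral_enorm_mul_twistFactor_sub_one {f : EuclideanSpace ℂ (Fin n) → ℂ}
    (hf : Integrable f) :
    Tendsto (fun w => ∫⁻ z, ‖f z‖ₑ * ‖twistFactor z w - 1‖ₑ) (𝓝 0) (𝓝 0) := by
  rw [← lintegral_zero (μ := (volume : Measure (EuclideanSpace ℂ (Fin n))))]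
  refine tendsto_lintegral_filter_of_dominated_convergence' (fun z => ‖f z‖ₑ * 2)
    (Eventually.of_forall fun w => ?_) (Eventually.of_forall fun w => ae_of_all _ fun z => ?_)
    ?_ (ae_of_all _ fun z => ?_)
  · have : Continuous fun z => ‖twistFactor z w - 1‖ₑ :=
      ((continuous_twistFactor continuous_id continuous_const).sub continuous_const).enorm
    exact hf.1.enorm.mul this.aemeasurable
  · gcongr
    exact enorm_twistFactor_sub_one_le z w
  · rw [lintegral_mul_const'' _ hf.1.enorm]
    exact ENNReal.mul_ne_top hf.2.ne ENNReal.ofNat_ne_top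
  · have h_cont : Continuous fun w => ‖twistFactor z w - 1‖ₑ :=
      ((continuous_twistFactor continuous_const continuous_id).sub continuous_const).enorm
    have h_lim := h_cont.tendsto 0
    rw [twistFactor_zero_right, sub_self, enorm_zero] at h_lim
    simpa using ENNReal.Tendsto.const_mul h_lim (Or.inr enorm_ne_top)

theorem tendsto_lintegral_twisted_translate_sub {f : EuclideanSpace ℂ (Fin n) → ℂ}
    (hf : Integrable f) :
    Tendsto (fun w => ∫⁻ z, ‖f (z - w) * twistFactor z w - f z‖ₑ) (𝓝 0) (𝓝 0) := by
  have h_translate := tendsto_eLpNorm_translate_sub ENNReal.one_ne_top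
    (memLp_one_iff_integrable.2 hf)
  simp only [eLpNorm_one_eq_lintegral_enorm] at h_translate
  have h_add := (tendsto_lintegral_enorm_mul_twistFactor_sub_one hf).add h_translate
  rw [add_zero] at h_add
  refine tendsto_of_tendsto_of_tendsto_of_le_of_le tendsto_const_nhds h_add (fun _ => zero_le)
    fun w => ?_
  have h_shift : ∫⁻ z, ‖f z‖ₑ * ‖twistFactor z w - 1‖ₑ =
      ∫⁻ z, ‖f (z - w) * (twistFactor z w - 1)‖ₑ := by
    rw [← lintegral_sub_right_eq_self _ w]
    simp only [twistFactor_sub_self_left, enorm_mul]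
  have h_meas : AEStronglyMeasurable fun z => f (z - w) * (twistFactor z w - 1) :=
    (hf.comp_sub_right w).1.mul ((continuous_twistFactor continuous_id continuous_const).sub
      continuous_const).aestronglyMeasurable
  dsimp only
  rw [h_shift, ← lintegral_add_left' h_meas.enorm]
  refine lintegral_mono fun z => ?_
  have h_split : f (z - w) * twistFactor z w - f z =
      f (z - w) * (twistFactor z w - 1) + (f (z - w) - f z) := by ring
  rw [h_split]
  exact enorm_add_le _ _

theorem ae_integrable_twistedConv_integrand {f g : EuclideanSpace ℂ (Fin n) → ℂ}
    (hf : Integrable f) (hg : Integrable g) :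
    ∀ᵐ z, Integrable fun w => f (z - w) * g w * twistFactor z w := by
  filter_upwards [hg.ae_convolution_exists (.mul ℝ ℂ) hf] with z hz
  have h_conv : Integrable fun w => f (z - w) * g w := by
    simpa only [ConvolutionExistsAt, ContinuousLinearMap.mul_apply', mul_comm] using hz
  exact h_conv.mul_bdd (c := 1)
    (continuous_twistFactor continuous_const continuous_id).aestronglyMeasurable
    (ae_of_all _ fun w => (norm_twistFactor z w).le)

theorem twistedConv_sub_self_eq_integral {f ρ : EuclideanSpace ℂ (Fin n) → ℂ}
    (hf : Integrable f) (hρ : ∫ w, ρ w = 1) :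
    ∀ᵐ z, twistedConv f ρ z - f z = ∫ w, ρ w * (f (z - w) * twistFactor z w - f z) := by
  have hρ_int : Integrable ρ := .of_integral_ne_zero (by rw [hρ]; exact one_ne_zero)
  filter_upwards [ae_integrable_twistedConv_integrand hf hρ_int] with z hz
  have h_const : ∫ w, ρ w * f z = f z := by rw [integral_mul_const, hρ, one_mul]
  calc twistedConv f ρ z - f z
      = (∫ w, ρ w * f (z - w) * twistFactor z w) - ∫ w, ρ w * f z := by
        rw [h_const, twistedConv_apply]
        congr 2 with w
        ring
    _ = ∫ w, ρ w * (f (z - w) * twistFactor z w - f z) := by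
        rw [← integral_sub (hz.congr (.of_forall fun w => by ring)) (hρ_int.mul_const _)]
        congr 1 with w
        ring

theorem eLpNorm_twistedConv_sub_self_le {f ρ : EuclideanSpace ℂ (Fin n) → ℂ}
    (hf : Integrable f) (hρ : ∫ w, ρ w = 1) :
    eLpNorm (twistedConv f ρ - f) 1 volume ≤
      ∫⁻ w, ‖ρ w‖ₑ * ∫⁻ z, ‖f (z - w) * twistFactor z w - f z‖ₑ := by
  have hρ_int : Integrable ρ := .of_integral_ne_zero (by rw [hρ]; exact one_ne_zero)
  have h_meas : AEStronglyMeasurable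
      (fun p : EuclideanSpace ℂ (Fin n) × EuclideanSpace ℂ (Fin n) =>
        ρ p.2 * (f (p.1 - p.2) * twistFactor p.1 p.2 - f p.1)) (volume.prod volume) :=
    hρ_int.1.comp_snd.mul (((hf.1.comp_quasiMeasurePreserving
      (quasiMeasurePreserving_sub_of_right_invariant volume volume)).mul
        (continuous_twistFactor continuous_fst continuous_snd).aestronglyMeasurable).sub
          hf.1.comp_fst)
  rw [eLpNorm_one_eq_lintegral_enorm]
  calc ∫⁻ z, ‖(twistedConv f ρ - f) z‖ₑ
      ≤ ∫⁻ z, ∫⁻ w, ‖ρ w * (f (z - w) * twistFactor z w - f z)‖ₑ := by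
        refine lintegral_mono_ae ?_
        filter_upwards [twistedConv_sub_self_eq_integral hf hρ] with z hz
        rw [Pi.sub_apply, hz]
        exact enorm_integral_le_lintegral_enorm _
    _ = ∫⁻ w, ∫⁻ z, ‖ρ w * (f (z - w) * twistFactor z w - f z)‖ₑ :=
        lintegral_lintegral_swap h_meas.enorm
    _ = ∫⁻ w, ‖ρ w‖ₑ * ∫⁻ z, ‖f (z - w) * twistFactor z w - f z‖ₑ := by
        simp only [enorm_mul, lintegral_const_mul' _ _ enorm_ne_top]

theorem tendsto_eLpNorm_twistedConv_sub_self {ι : Type*} {l : Filter ι}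
    {ρ : ι → EuclideanSpace ℂ (Fin n) → ℂ} {C : ℝ≥0∞} (hC : C ≠ ∞)
    (hρ_supp : Tendsto (fun i => Function.support (ρ i)) l (𝓝 0).smallSets)
    (hρ_norm : ∀ᶠ i in l, eLpNorm (ρ i) 1 volume ≤ C) (hρ : ∀ᶠ i in l, ∫ w, ρ i w = 1)
    {f : EuclideanSpace ℂ (Fin n) → ℂ} (hf : Integrable f) :
    Tendsto (fun i => eLpNorm (twistedConv f (ρ i) - f) 1 volume) l (𝓝 0) := by
  refine ENNReal.tendsto_nhds_zero.2 fun ε hε => ?_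
  obtain ⟨η, hη_pos, hη⟩ := ENNReal.exists_pos_mul_lt hC hε.ne'
  have h_near := ENNReal.tendsto_nhds_zero.1 (tendsto_lintegral_twisted_translate_sub hf) η hη_pos
  filter_upwards [hρ_supp.eventually (eventually_smallSets_forall.2 h_near), hρ_norm, hρ]
    with i hi_near hi_norm hi
  calc eLpNorm (twistedConv f (ρ i) - f) 1 volume
      ≤ ∫⁻ w, ‖ρ i w‖ₑ * ∫⁻ z, ‖f (z - w) * twistFactor z w - f z‖ₑ :=
        eLpNorm_twistedConv_sub_self_le hf hi
    _ ≤ ∫⁻ w, ‖ρ i w‖ₑ * η := by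
        refine lintegral_mono fun w => ?_
        by_cases hw : ρ i w = 0
        · simp only [hw, enorm_zero, zero_mul, le_refl]
        · exact mul_le_mul_right (hi_near w hw) _
    _ = eLpNorm (ρ i) 1 volume * η := by
        rw [eLpNorm_one_eq_lintegral_enorm, lintegral_mul_const'' _ ?_]
        exact (Integrable.of_integral_ne_zero (by rw [hi]; exact one_ne_zero)).1.enorm
    _ ≤ C * η := mul_le_mul_left hi_norm η
    _ ≤ ε := by rw [mul_comm]; exact hη.le

end ApproximateIdentity

/-! ### Iterated averages -/

section LeftMean

open scoped ContDiff

/-- The mean of `F` over `[x - a, x]`. Averaging a function `N` times bounds its derivatives up to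
order `N` by powers of `2 / a`, at the cost of enlarging its support by `N * a`. -/
noncomputable def leftMean (a : ℝ) (F : ℝ → ℝ) (x : ℝ) : ℝ := a⁻¹ * ∫ t in (x - a)..x, F t

variable {a c M : ℝ} {F : ℝ → ℝ}

theorem hasDerivAt_leftMean (hF : Continuous F) (a x : ℝ) :
    HasDerivAt (leftMean a F) (a⁻¹ * (F x - F (x - a))) x := by
  have h_eq : leftMean a F =
      fun x => a⁻¹ * ((∫ t in (0 : ℝ)..x, F t) - ∫ t in (0 : ℝ)..(x - a), F t) := by
    funext x
    rw [leftMean, intervalIntegral.integral_interval_sub_left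
      (hF.intervalIntegrable _ _) (hF.intervalIntegrable _ _)]
  have h_prim (y : ℝ) : HasDerivAt (fun x => ∫ t in (0 : ℝ)..x, F t) (F y) y :=
    hF.integral_hasStrictDerivAt 0 y |>.hasDerivAt
  rw [h_eq]
  exact ((h_prim x).sub ((h_prim (x - a)).comp_sub_const x a)).const_mul _

theorem leftMean_deriv (hF : ContDiff ℝ 1 F) (a x : ℝ) :
    leftMean a (deriv F) x = a⁻¹ * (F x - F (x - a)) := by
  rw [leftMean, intervalIntegral.integral_deriv_eq_sub (fun t _ => hF.differentiable_one t)
    ((hF.continuous_deriv le_rfl).intervalIntegrable _ _)]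

theorem deriv_leftMean (hF : ContDiff ℝ 1 F) (a : ℝ) :
    deriv (leftMean a F) = leftMean a (deriv F) :=
  funext fun x => by rw [(hasDerivAt_leftMean hF.continuous a x).deriv, leftMean_deriv hF]

theorem contDiff_leftMean (hF : ContDiff ℝ ∞ F) (a : ℝ) : ContDiff ℝ ∞ (leftMean a F) := by
  have h_deriv : deriv (leftMean a F) = fun x => a⁻¹ * (F x - F (x - a)) :=
    funext fun x => (hasDerivAt_leftMean hF.continuous a x).deriv
  refine contDiff_infty_iff_deriv.2
    ⟨fun x => (hasDerivAt_leftMean hF.continuous a x).differentiableAt, ?_⟩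
  rw [h_deriv]
  fun_prop

theorem contDiff_iteratedDeriv_infty (hF : ContDiff ℝ ∞ F) (j : ℕ) :
    ContDiff ℝ ∞ (iteratedDeriv j F) := by
  rw [iteratedDeriv_eq_iterate]
  exact hF.iterate_deriv j

theorem iteratedDeriv_leftMean (hF : ContDiff ℝ ∞ F) (a : ℝ) (j : ℕ) :
    iteratedDeriv j (leftMean a F) = leftMean a (iteratedDeriv j F) := by
  induction j with
  | zero => simp only [iteratedDeriv_zero]
  | succ j ih =>
    have h_one : ContDiff ℝ 1 (iteratedDeriv j F) :=
      contDiff_infty.1 (contDiff_iteratedDeriv_infty hF j) 1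
    rw [iteratedDeriv_succ, ih, deriv_leftMean h_one, iteratedDeriv_succ]

theorem abs_leftMean_le (ha : 0 < a) {x : ℝ} (hF : ∀ t ∈ Set.Icc (x - a) x, |F t| ≤ M) :
    |leftMean a F x| ≤ M := by
  have h := intervalIntegral.norm_integral_le_of_norm_le_const (a := x - a) (b := x) (f := F)
    (C := M) fun _ ht => hF _ (Set.Ioc_subset_Icc_self (Set.uIoc_of_le (sub_le_self x ha.le) ▸ ht))
  rw [Real.norm_eq_abs, sub_sub_cancel, abs_of_pos ha, mul_comm] at h
  rwa [leftMean, abs_mul, abs_of_pos (inv_pos.2 ha), inv_mul_le_iff₀ ha]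

theorem leftMean_eq_const (ha : 0 < a) {x : ℝ} (hF : ∀ t ∈ Set.Icc (x - a) x, F t = c) :
    leftMean a F x = c := by
  have h_int : ∫ t in (x - a)..x, F t = ∫ _ in (x - a)..x, c :=
    intervalIntegral.integral_congr ((Set.uIcc_of_le (sub_le_self x ha.le)).symm ▸ hF)
  rw [leftMean, h_int, intervalIntegral.integral_const, sub_sub_cancel, smul_eq_mul,
    inv_mul_cancel_left₀ ha.ne']

theorem abs_leftMean_sub_le (ha : 0 < a) (hF : ContDiff ℝ 1 F) (hM : ∀ x, |deriv F x| ≤ M) (x : ℝ) :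
    |leftMean a F x - F x| ≤ a * M := by
  have h_sub : leftMean a F x - F x = leftMean a (fun t => F t - F x) x := by
    rw [leftMean, leftMean, intervalIntegral.integral_sub (hF.continuous.intervalIntegrable _ _)
      intervalIntegrable_const, intervalIntegral.integral_const, sub_sub_cancel, smul_eq_mul,
      mul_sub, inv_mul_cancel_left₀ ha.ne']
  rw [h_sub]
  refine abs_leftMean_le ha fun t ht => ?_
  have h_lip := convex_univ.norm_image_sub_le_of_norm_deriv_le
    (fun y _ => hF.differentiable_one y) (fun y _ => hM y) (Set.mem_univ x) (Set.mem_univ t)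
  have h_dist : |t - x| ≤ a := abs_le.2 ⟨by linarith [ht.1], by linarith [ht.2]⟩
  calc |F t - F x| ≤ M * |t - x| := h_lip
    _ ≤ M * a := mul_le_mul_of_nonneg_left h_dist ((abs_nonneg _).trans (hM 0))
    _ = a * M := mul_comm _ _

theorem leftMean_nonneg (ha : 0 < a) (hF : ∀ x, 0 ≤ F x) (x : ℝ) : 0 ≤ leftMean a F x :=
  mul_nonneg (inv_pos.2 ha).le
    (intervalIntegral.integral_nonneg (sub_le_self x ha.le) fun t _ => hF t)

theorem contDiff_iterate_leftMean (hF : ContDiff ℝ ∞ F) (a : ℝ) (N : ℕ) :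
    ContDiff ℝ ∞ ((leftMean a)^[N] F) :=
  Function.Iterate.rec (ContDiff ℝ ∞) hF (fun _ hG => contDiff_leftMean hG a) N

theorem iteratedDeriv_iterate_leftMean (hF : ContDiff ℝ ∞ F) (a : ℝ) (N j : ℕ) :
    iteratedDeriv j ((leftMean a)^[N] F) = (leftMean a)^[N] (iteratedDeriv j F) := by
  induction N with
  | zero => rfl
  | succ N ih =>
    rw [Function.iterate_succ_apply', iteratedDeriv_leftMean (contDiff_iterate_leftMean hF a N), ih,
      Function.iterate_succ_apply']

theorem abs_iterate_leftMean_le (ha : 0 < a) (hF : ∀ x, |F x| ≤ M) (N : ℕ) :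
    ∀ x, |(leftMean a)^[N] F x| ≤ M :=
  Function.Iterate.rec (fun G : ℝ → ℝ => ∀ x, |G x| ≤ M) hF
    (fun _ hG _ => abs_leftMean_le ha fun t _ => hG t) N

theorem iterate_leftMean_nonneg (ha : 0 < a) (hF : ∀ x, 0 ≤ F x) (N : ℕ) :
    ∀ x, 0 ≤ (leftMean a)^[N] F x :=
  Function.Iterate.rec (fun G : ℝ → ℝ => ∀ x, 0 ≤ G x) hF (fun _ => leftMean_nonneg ha) N

theorem iterate_leftMean_eq_const (ha : 0 < a) (N : ℕ) {x : ℝ}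
    (hF : ∀ t ∈ Set.Icc (x - N * a) x, F t = c) : (leftMean a)^[N] F x = c := by
  induction N generalizing x with
  | zero => exact hF x ⟨by rw [Nat.cast_zero, zero_mul, sub_zero], le_rfl⟩
  | succ N ih =>
    rw [Function.iterate_succ_apply']
    refine leftMean_eq_const ha fun t ht => ih fun s hs => hF s ⟨?_, hs.2.trans ht.2⟩
    push_cast
    linarith [hs.1, ht.1]

theorem abs_iterate_leftMean_sub_le (ha : 0 < a) (hF : ContDiff ℝ ∞ F)
    (hM : ∀ x, |deriv F x| ≤ M) (N : ℕ) (x : ℝ) : |(leftMean a)^[N] F x - F x| ≤ N * a * M := by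
  induction N with
  | zero => rw [Function.iterate_zero_apply, sub_self, abs_zero, Nat.cast_zero, zero_mul, zero_mul]
  | succ N ih =>
    have h_one : ContDiff ℝ 1 ((leftMean a)^[N] F) :=
      contDiff_infty.1 (contDiff_iterate_leftMean hF a N) 1
    have h_deriv (y : ℝ) : |deriv ((leftMean a)^[N] F) y| ≤ M := by
      rw [← iteratedDeriv_one, iteratedDeriv_iterate_leftMean hF, iteratedDeriv_one]
      exact abs_iterate_leftMean_le ha hM N y
    rw [Function.iterate_succ_apply']
    calc |leftMean a ((leftMean a)^[N] F) x - F x|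
        ≤ |leftMean a ((leftMean a)^[N] F) x - (leftMean a)^[N] F x|
          + |(leftMean a)^[N] F x - F x| := abs_sub_le _ _ _
      _ ≤ a * M + N * a * M := add_le_add
          (abs_leftMean_sub_le ha h_one h_deriv x) ih
      _ = (N + 1 : ℕ) * a * M := by push_cast; ring

-- Each average absorbs one derivative, turning it into a difference quotient of step `a`.
theorem abs_iterate_leftMean_iteratedDeriv_le (ha : 0 < a) (hF : ContDiff ℝ ∞ F)
    (hM : ∀ x, |F x| ≤ M) (j : ℕ) (x : ℝ) :
    |(leftMean a)^[j] (iteratedDeriv j F) x| ≤ (2 / a) ^ j * M := by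
  induction j generalizing F M x with
  | zero => simpa using hM x
  | succ j ih =>
    have hF' : ContDiff ℝ ∞ (deriv F) := (contDiff_infty_iff_deriv.1 hF).2
    have h_diff (x : ℝ) : |leftMean a (deriv F) x| ≤ 2 / a * M := by
      rw [leftMean_deriv (contDiff_infty.1 hF 1), abs_mul, abs_of_pos (inv_pos.2 ha),
        inv_mul_le_iff₀ ha]
      calc |F x - F (x - a)| ≤ |F x| + |F (x - a)| := abs_sub _ _
        _ ≤ M + M := add_le_add (hM x) (hM (x - a))
        _ = a * (2 / a * M) := by field_simp; ring
    rw [Function.iterate_succ_apply, iteratedDeriv_succ', ← iteratedDeriv_leftMean hF']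
    exact (ih (contDiff_leftMean hF' a) h_diff x).trans_eq (by ring)

theorem abs_iteratedDeriv_iterate_leftMean_le (ha : 0 < a) (hF : ContDiff ℝ ∞ F)
    (hM : ∀ x, |F x| ≤ M) {j N : ℕ} (hj : j ≤ N) (x : ℝ) :
    |iteratedDeriv j ((leftMean a)^[N] F) x| ≤ (2 / a) ^ j * M := by
  obtain ⟨d, rfl⟩ := Nat.exists_eq_add_of_le' hj
  rw [iteratedDeriv_iterate_leftMean hF, Function.iterate_add_apply]
  exact abs_iterate_leftMean_le ha (abs_iterate_leftMean_iteratedDeriv_le ha hF hM j) d x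

end LeftMean

section LeftMeanSeq

open scoped ContDiff

/-- Successive averages of `v`, with `N p` averages over intervals of length `a p` at stage `p`. -/
noncomputable def leftMeanSeq (a : ℕ → ℝ) (N : ℕ → ℕ) (v : ℝ → ℝ) : ℕ → ℝ → ℝ
  | 0 => v
  | p + 1 => (leftMean (a p))^[N p] (leftMeanSeq a N v p)

/-- The limit of the successive averages `leftMeanSeq a N v`, written as a telescoping series. -/
noncomputable def leftMeanLimit (a : ℕ → ℝ) (N : ℕ → ℕ) (v : ℝ → ℝ) : ℝ → ℝ :=
  v + fun x => ∑' p, (leftMeanSeq a N v (p + 1) - leftMeanSeq a N v p) x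

variable {a : ℕ → ℝ} {N : ℕ → ℕ} {v : ℝ → ℝ}

theorem contDiff_leftMeanSeq (hv : ContDiff ℝ ∞ v) (p : ℕ) :
    ContDiff ℝ ∞ (leftMeanSeq a N v p) := by
  induction p with
  | zero => exact hv
  | succ p ih => exact contDiff_iterate_leftMean ih _ _

theorem abs_iteratedDeriv_leftMeanSeq_le_of_le (ha : ∀ p, 0 < a p) (hv : ContDiff ℝ ∞ v)
    {j q : ℕ} {M : ℝ} (hM : ∀ x, |iteratedDeriv j (leftMeanSeq a N v q) x| ≤ M) {p : ℕ}
    (hqp : q ≤ p) : ∀ x, |iteratedDeriv j (leftMeanSeq a N v p) x| ≤ M := by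
  induction p, hqp using Nat.le_induction with
  | base => exact hM
  | succ p _ ih =>
    rw [leftMeanSeq, iteratedDeriv_iterate_leftMean (contDiff_leftMeanSeq hv p)]
    exact abs_iterate_leftMean_le (ha p) ih _

theorem abs_iteratedDeriv_leftMeanSeq_le (ha : ∀ p, 0 < a p) (hv : ContDiff ℝ ∞ v) {M : ℝ}
    (hM : ∀ x, |v x| ≤ M) {p q j : ℕ} (hpq : p < q) (hj : j ≤ N p) (x : ℝ) :
    |iteratedDeriv j (leftMeanSeq a N v q) x| ≤ (2 / a p) ^ j * M := by
  have h_bound : ∀ x, |leftMeanSeq a N v p x| ≤ M := by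
    simpa only [iteratedDeriv_zero] using
      abs_iteratedDeriv_leftMeanSeq_le_of_le ha hv (j := 0) hM p.zero_le
  exact abs_iteratedDeriv_leftMeanSeq_le_of_le ha hv
    (abs_iteratedDeriv_iterate_leftMean_le (ha p) (contDiff_leftMeanSeq hv p) h_bound hj) hpq x

theorem leftMeanSeq_nonneg (ha : ∀ p, 0 < a p) (hv : ∀ x, 0 ≤ v x) (p : ℕ) :
    ∀ x, 0 ≤ leftMeanSeq a N v p x := by
  induction p with
  | zero => exact hv
  | succ p ih => exact iterate_leftMean_nonneg (ha p) ih _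

theorem leftMeanSeq_eq_const (ha : ∀ p, 0 < a p) {c : ℝ} (p : ℕ) {x : ℝ}
    (hv : ∀ t ∈ Set.Icc (x - ∑ q ∈ Finset.range p, N q * a q) x, v t = c) :
    leftMeanSeq a N v p x = c := by
  induction p generalizing x with
  | zero => exact hv x ⟨by rw [Finset.sum_range_zero, sub_zero], le_rfl⟩
  | succ p ih =>
    refine iterate_leftMean_eq_const (ha p) _ fun t ht => ih fun s hs =>
      hv s ⟨?_, hs.2.trans ht.2⟩
    rw [Finset.sum_range_succ]
    linarith [hs.1, ht.1]

theorem iteratedDeriv_leftMeanSeq_succ_sub (hv : ContDiff ℝ ∞ v) (j p : ℕ) (x : ℝ) :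
    iteratedDeriv j (leftMeanSeq a N v (p + 1) - leftMeanSeq a N v p) x =
      iteratedDeriv j (leftMeanSeq a N v (p + 1)) x - iteratedDeriv j (leftMeanSeq a N v p) x :=
  iteratedDeriv_sub (contDiff_infty.1 (contDiff_leftMeanSeq hv (p + 1)) j).contDiffAt
    (contDiff_infty.1 (contDiff_leftMeanSeq hv p) j).contDiffAt

theorem abs_iteratedDeriv_leftMeanSeq_succ_sub_le (ha : ∀ p, 0 < a p) (hv : ContDiff ℝ ∞ v)
    {j : ℕ} {M : ℝ} (hM : ∀ x, |iteratedDeriv (j + 1) v x| ≤ M) (p : ℕ) (x : ℝ) :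
    |iteratedDeriv j (leftMeanSeq a N v (p + 1) - leftMeanSeq a N v p) x| ≤ N p * a p * M := by
  have h_smooth := contDiff_leftMeanSeq (a := a) (N := N) hv p
  rw [iteratedDeriv_leftMeanSeq_succ_sub hv, leftMeanSeq, iteratedDeriv_iterate_leftMean h_smooth]
  refine abs_iterate_leftMean_sub_le (ha p) (contDiff_iteratedDeriv_infty h_smooth j)
    (fun y => ?_) _ x
  rw [← iteratedDeriv_succ]
  exact abs_iteratedDeriv_leftMeanSeq_le_of_le ha hv hM p.zero_le y

theorem hasSum_iteratedDeriv_tsum {ι E : Type*} [NormedAddCommGroup E] [NormedSpace ℝ E]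
    [CompleteSpace E] {f : ι → ℝ → E} {u : ℕ → ι → ℝ} (hf : ∀ i, ContDiff ℝ ∞ (f i))
    (hu : ∀ j, Summable (u j)) (hfu : ∀ j i x, ‖iteratedDeriv j (f i) x‖ ≤ u j i)
    (j : ℕ) (x : ℝ) :
    HasSum (fun i => iteratedDeriv j (f i) x) (iteratedDeriv j (fun x => ∑' i, f i x) x) := by
  simp only [← norm_iteratedFDeriv_eq_norm_iteratedDeriv] at hfu
  have h_summable : Summable fun i => iteratedFDeriv ℝ j (f i) x :=
    .of_norm_bounded (hu j) fun i => hfu j i x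
  simp only [iteratedDeriv_eq_iteratedFDeriv]
  rw [iteratedFDeriv_tsum_apply hf (fun j _ => hu j) (fun j i x _ => hfu j i x) le_top x]
  exact (ContinuousMultilinearMap.apply ℝ (fun _ : Fin j => ℝ) E fun _ => 1).hasSum
    h_summable.hasSum

theorem contDiff_tsum_leftMeanSeq_succ_sub (ha : ∀ p, 0 < a p)
    (hs : Summable fun p => N p * a p) (hv : ContDiff ℝ ∞ v)
    (hv_bdd : ∀ j, ∃ M, ∀ x, |iteratedDeriv j v x| ≤ M) :
    ContDiff ℝ ∞ (fun x => ∑' p, (leftMeanSeq a N v (p + 1) - leftMeanSeq a N v p) x) := by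
  choose M hM using hv_bdd
  refine contDiff_tsum (v := fun j p => N p * a p * M (j + 1))
    (fun p => (contDiff_leftMeanSeq hv _).sub (contDiff_leftMeanSeq hv _))
    (fun j _ => hs.mul_right _) fun j p x _ => ?_
  rw [norm_iteratedFDeriv_eq_norm_iteratedDeriv]
  exact abs_iteratedDeriv_leftMeanSeq_succ_sub_le ha hv (hM (j + 1)) p x

theorem contDiff_leftMeanLimit (ha : ∀ p, 0 < a p) (hs : Summable fun p => N p * a p)
    (hv : ContDiff ℝ ∞ v) (hv_bdd : ∀ j, ∃ M, ∀ x, |iteratedDeriv j v x| ≤ M) :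
    ContDiff ℝ ∞ (leftMeanLimit a N v) :=
  hv.add (contDiff_tsum_leftMeanSeq_succ_sub ha hs hv hv_bdd)

theorem tendsto_iteratedDeriv_leftMeanSeq (ha : ∀ p, 0 < a p) (hs : Summable fun p => N p * a p)
    (hv : ContDiff ℝ ∞ v) (hv_bdd : ∀ j, ∃ M, ∀ x, |iteratedDeriv j v x| ≤ M) (j : ℕ) (x : ℝ) :
    Tendsto (fun p => iteratedDeriv j (leftMeanSeq a N v p) x) atTop
      (𝓝 (iteratedDeriv j (leftMeanLimit a N v) x)) := by
  have h_add := iteratedDeriv_add (contDiff_infty.1 hv j).contDiffAt (contDiff_infty.1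
    (contDiff_tsum_leftMeanSeq_succ_sub ha hs hv hv_bdd) j).contDiffAt (x := x)
  choose M hM using hv_bdd
  have h_tendsto := (hasSum_iteratedDeriv_tsum
    (f := fun p => leftMeanSeq a N v (p + 1) - leftMeanSeq a N v p)
    (fun p => (contDiff_leftMeanSeq hv (p + 1)).sub (contDiff_leftMeanSeq hv p))
    (fun j => hs.mul_right (M (j + 1)))
    (fun j p x => abs_iteratedDeriv_leftMeanSeq_succ_sub_le ha hv (hM (j + 1)) p x)
    j x).tendsto_sum_nat.const_add (iteratedDeriv j v x)
  rw [leftMeanLimit, h_add]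
  refine h_tendsto.congr fun p => ?_
  simp only [iteratedDeriv_leftMeanSeq_succ_sub hv]
  rw [Finset.sum_range_sub fun q => iteratedDeriv j (leftMeanSeq a N v q) x]
  exact add_sub_cancel _ _

theorem tendsto_leftMeanSeq (ha : ∀ p, 0 < a p) (hs : Summable fun p => N p * a p)
    (hv : ContDiff ℝ ∞ v) (hv_bdd : ∀ j, ∃ M, ∀ x, |iteratedDeriv j v x| ≤ M) (x : ℝ) :
    Tendsto (fun p => leftMeanSeq a N v p x) atTop (𝓝 (leftMeanLimit a N v x)) := by
  simpa only [iteratedDeriv_zero] using tendsto_iteratedDeriv_leftMeanSeq ha hs hv hv_bdd 0 x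

theorem leftMeanLimit_eq_const (ha : ∀ p, 0 < a p) (hs : Summable fun p => N p * a p)
    (hv : ContDiff ℝ ∞ v) (hv_bdd : ∀ j, ∃ M, ∀ x, |iteratedDeriv j v x| ≤ M) {c x : ℝ}
    (hvc : ∀ t ∈ Set.Icc (x - ∑' p, N p * a p) x, v t = c) : leftMeanLimit a N v x = c := by
  refine tendsto_nhds_unique (tendsto_leftMeanSeq ha hs hv hv_bdd x)
    (tendsto_const_nhds.congr fun p => .symm <|
      leftMeanSeq_eq_const ha p fun t ht => hvc t ⟨?_, ht.2⟩)
  have h_sum : ∑ q ∈ Finset.range p, N q * a q ≤ ∑' q, N q * a q :=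
    hs.sum_le_tsum _ fun q _ => mul_nonneg (Nat.cast_nonneg _) (ha q).le
  linarith [ht.1]

theorem leftMeanLimit_nonneg (ha : ∀ p, 0 < a p) (hs : Summable fun p => N p * a p)
    (hv : ContDiff ℝ ∞ v) (hv_bdd : ∀ j, ∃ M, ∀ x, |iteratedDeriv j v x| ≤ M)
    (hv_nonneg : ∀ x, 0 ≤ v x) (x : ℝ) : 0 ≤ leftMeanLimit a N v x :=
  ge_of_tendsto' (tendsto_leftMeanSeq ha hs hv hv_bdd x) fun p =>
    leftMeanSeq_nonneg ha hv_nonneg p x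

theorem abs_iteratedDeriv_leftMeanLimit_le (ha : ∀ p, 0 < a p) (hs : Summable fun p => N p * a p)
    (hv : ContDiff ℝ ∞ v) (hv_bdd : ∀ j, ∃ M, ∀ x, |iteratedDeriv j v x| ≤ M) {M : ℝ}
    (hM : ∀ x, |v x| ≤ M) {p j : ℕ} (hj : j ≤ N p) (x : ℝ) :
    |iteratedDeriv j (leftMeanLimit a N v) x| ≤ (2 / a p) ^ j * M := by
  refine le_of_tendsto (tendsto_iteratedDeriv_leftMeanSeq ha hs hv hv_bdd j x).abs ?_
  filter_upwards [eventually_gt_atTop p] with q hq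
  exact abs_iteratedDeriv_leftMeanSeq_le ha hv hM hq hj x

theorem exists_abs_iteratedDeriv_le_of_hasCompactSupport (hv : ContDiff ℝ ∞ v)
    (hv_supp : HasCompactSupport v) (j : ℕ) : ∃ M, ∀ x, |iteratedDeriv j v x| ≤ M := by
  obtain ⟨M, hM⟩ := (hv_supp.iteratedFDeriv (𝕜 := ℝ) j).exists_bound_of_continuous
    ((contDiff_infty.1 hv j).continuous_iteratedFDeriv le_rfl)
  simp only [norm_iteratedFDeriv_eq_norm_iteratedDeriv] at hM
  exact ⟨M, hM⟩

theorem exists_contDiff_abs_iteratedDeriv_le {r : ℝ} (hr : 0 < r) (ha : ∀ p, 0 < a p)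
    (hs : Summable fun p => N p * a p) (hsum : ∑' p, N p * a p ≤ r) :
    ∃ ψ : ℝ → ℝ, ContDiff ℝ ∞ ψ ∧ (∀ x, 0 ≤ ψ x) ∧ ψ 0 = 1 ∧ (∀ x, 3 * r < |x| → ψ x = 0) ∧
      ∀ p j, j ≤ N p → ∀ x, |iteratedDeriv j ψ x| ≤ (2 / a p) ^ j := by
  let v : ContDiffBump (0 : ℝ) := ⟨r, 2 * r, hr, by linarith⟩
  have hv_bdd := exists_abs_iteratedDeriv_le_of_hasCompactSupport v.contDiff v.hasCompactSupport
  refine ⟨leftMeanLimit a N v, contDiff_leftMeanLimit ha hs v.contDiff hv_bdd,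
    leftMeanLimit_nonneg ha hs v.contDiff hv_bdd fun _ => v.nonneg,
    leftMeanLimit_eq_const ha hs v.contDiff hv_bdd fun t ht => v.one_of_mem_closedBall ?_,
    fun x hx => leftMeanLimit_eq_const ha hs v.contDiff hv_bdd fun t ht => v.zero_of_le_dist ?_,
    fun p j hj x => ?_⟩
  · rw [mem_closedBall_zero_iff, Real.norm_eq_abs]
    exact abs_le.2 ⟨by linarith [ht.1], ht.2.trans hr.le⟩
  · rw [dist_zero_right, Real.norm_eq_abs]
    change 2 * r ≤ |t|
    rcases lt_abs.1 hx with hx_pos | hx_neg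
    · exact le_abs.2 (.inl (by linarith [ht.1]))
    · exact le_abs.2 (.inr (by linarith [ht.2]))
  · have h_one (x : ℝ) : |v x| ≤ 1 := (abs_of_nonneg v.nonneg).trans_le v.le_one
    simpa only [mul_one] using
      abs_iteratedDeriv_leftMeanLimit_le ha hs v.contDiff hv_bdd h_one hj x

end LeftMeanSeq

/-! ### Iterates of the radial twisted Laplacian -/

section IterateBounds

open scoped ContDiff

variable {n : ℕ} {f : ℝ → ℝ} {R b : ℝ}

theorem hasDerivAt_iteratedDeriv (hf : ContDiff ℝ ∞ f) (j : ℕ) (s : ℝ) :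
    HasDerivAt (iteratedDeriv j f) (iteratedDeriv (j + 1) f s) s := by
  rw [iteratedDeriv_succ]
  exact ((contDiff_iteratedDeriv_infty hf j).differentiable (by simp) s).hasDerivAt

-- At `j = 0` the last term vanishes because of its coefficient, whatever `j - 1` means.
theorem iteratedDeriv_radialTwistedLaplacian (hf : ContDiff ℝ ∞ f) (j : ℕ) :
    iteratedDeriv j (radialTwistedLaplacian n f) = fun s =>
      -4 * s * iteratedDeriv (j + 2) f s - 4 * (n + j) * iteratedDeriv (j + 1) f s +
        s / 4 * iteratedDeriv j f s + j / 4 * iteratedDeriv (j - 1) f s := by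
  induction j with
  | zero =>
    funext s
    simp only [iteratedDeriv_zero, radialTwistedLaplacian, zero_add, iteratedDeriv_succ,
      Nat.cast_zero, add_zero, zero_div, zero_mul]
  | succ j ih =>
    funext s
    have h_two := ((hasDerivAt_id s).const_mul (-4)).mul (hasDerivAt_iteratedDeriv hf (j + 2) s)
    have h_one := (hasDerivAt_iteratedDeriv hf (j + 1) s).const_mul (4 * ((n : ℝ) + j))
    have h_zero := ((hasDerivAt_id s).div_const 4).mul (hasDerivAt_iteratedDeriv hf j s)
    have h_pred := (hasDerivAt_iteratedDeriv hf (j - 1) s).const_mul ((j : ℝ) / 4)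
    have h_succ_pred : (j : ℝ) / 4 * iteratedDeriv (j - 1 + 1) f s =
        (j : ℝ) / 4 * iteratedDeriv j f s := by
      rcases j with _ | j
      · rw [Nat.cast_zero, zero_div, zero_mul, zero_mul]
      · rw [Nat.add_sub_cancel]
    rw [h_succ_pred] at h_pred
    rw [iteratedDeriv_succ, ih]
    refine (((h_two.sub h_one).add h_zero).add h_pred).deriv.trans ?_
    simp only [id_eq, Nat.add_sub_cancel, Nat.cast_add, Nat.cast_one]
    ring

theorem abs_mul_iteratedDeriv_le (hfs : ∀ s, R < |s| → f s = 0) (hR : 0 ≤ R) {j : ℕ} {B : ℝ}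
    (hB : ∀ s, |iteratedDeriv j f s| ≤ B) (s : ℝ) : |s| * |iteratedDeriv j f s| ≤ R * B := by
  by_cases hs : R < |s|
  · have h_zero : iteratedDeriv j f s = 0 :=
      (Set.EqOn.iteratedDeriv_of_isOpen (g := 0) (s := {s | R < |s|}) (fun s => hfs s)
        (isOpen_lt continuous_const continuous_abs) j hs).trans iteratedDeriv_const_zero
    rw [h_zero, abs_zero, mul_zero]
    exact mul_nonneg hR ((abs_nonneg _).trans (hB s))
  · exact mul_le_mul (not_lt.1 hs) (hB s) (abs_nonneg _) hR

theorem abs_iteratedDeriv_radialTwistedLaplacian_le_add (hf : ContDiff ℝ ∞ f) (j : ℕ) (s : ℝ) :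
    |iteratedDeriv j (radialTwistedLaplacian n f) s| ≤
      4 * (|s| * |iteratedDeriv (j + 2) f s|) + 4 * ((n + j) * |iteratedDeriv (j + 1) f s|) +
        |s| * |iteratedDeriv j f s| / 4 + j * |iteratedDeriv (j - 1) f s| / 4 := by
  rw [iteratedDeriv_radialTwistedLaplacian hf]
  refine (abs_add_le _ _).trans (add_le_add ((abs_add_le _ _).trans
    (add_le_add ((abs_sub _ _).trans (add_le_add ?_ ?_)) ?_)) ?_)
  · rw [abs_mul, abs_mul, abs_neg, abs_of_pos (by norm_num : (0 : ℝ) < 4), mul_assoc]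
  · rw [abs_mul, abs_of_nonneg (by positivity), mul_assoc]
  · rw [abs_mul, abs_div, abs_of_pos (by norm_num : (0 : ℝ) < 4), div_mul_eq_mul_div]
  · rw [abs_mul, abs_of_nonneg (by positivity), div_mul_eq_mul_div]

/-- The factor by which one application of `radialTwistedLaplacian n` to a function supported in
`[-R, R]` enlarges bounds on its derivatives, see
`abs_iteratedDeriv_radialTwistedLaplacian_le`. -/
noncomputable def radialTwistedLaplacianConst (n : ℕ) (R : ℝ) : ℝ :=
  4 * R + 4 * (n + 1) + R / 4 + 1 / 4

theorem radialTwistedLaplacianConst_pos (n : ℕ) (hR : 0 ≤ R) :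
    0 < radialTwistedLaplacianConst n R := by
  rw [radialTwistedLaplacianConst]
  positivity

theorem abs_iteratedDeriv_radialTwistedLaplacian_le (hf : ContDiff ℝ ∞ f) (hR : 0 ≤ R)
    (hfs : ∀ s, R < |s| → f s = 0) (hb : 1 ≤ b) {K : ℝ} (hK : 0 ≤ K) {N c : ℕ} (hN : (N : ℝ) ≤ b)
    (hfb : ∀ j, j + c ≤ N → ∀ s, |iteratedDeriv j f s| ≤ K * b ^ (j + c)) {j : ℕ}
    (hj : j + (c + 2) ≤ N) (s : ℝ) :
    |iteratedDeriv j (radialTwistedLaplacian n f) s| ≤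
      radialTwistedLaplacianConst n R * K * b ^ (j + (c + 2)) := by
  set Q : ℝ := K * b ^ (j + (c + 2)) with hQ
  have h_pow {i : ℕ} (hi : i ≤ j + (c + 2)) : K * b ^ i ≤ Q :=
    mul_le_mul_of_nonneg_left (pow_le_pow_right₀ hb hi) hK
  have hjb : (j : ℝ) ≤ b := le_trans (by exact_mod_cast (by lia : j ≤ N)) hN
  have h_two : |s| * |iteratedDeriv (j + 2) f s| ≤ R * Q :=
    abs_mul_iteratedDeriv_le hfs hR
      (fun s => (hfb (j + 2) (by lia) s).trans (h_pow (by lia))) s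
  have h_one : (n + j) * |iteratedDeriv (j + 1) f s| ≤ (n + 1) * Q :=
    calc (n + j) * |iteratedDeriv (j + 1) f s|
        ≤ ((n + 1) * b) * (K * b ^ (j + 1 + c)) := by
          refine mul_le_mul ?_ (hfb (j + 1) (by lia) s) (abs_nonneg _) (by positivity)
          nlinarith [Nat.cast_nonneg (α := ℝ) n]
      _ = (n + 1) * (K * b ^ (j + 1 + c + 1)) := by ring
      _ ≤ (n + 1) * Q := by gcongr; exact h_pow (by lia)
  have h_zero : |s| * |iteratedDeriv j f s| ≤ R * Q :=
    abs_mul_iteratedDeriv_le hfs hR (fun s => (hfb j (by lia) s).trans (h_pow (by lia))) s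
  have h_pred : j * |iteratedDeriv (j - 1) f s| ≤ Q :=
    calc j * |iteratedDeriv (j - 1) f s|
        ≤ b * (K * b ^ (j - 1 + c)) :=
          mul_le_mul hjb (hfb (j - 1) (by lia) s) (abs_nonneg _) (by positivity)
      _ = K * b ^ (j - 1 + c + 1) := by ring
      _ ≤ Q := h_pow (by lia)
  refine (abs_iteratedDeriv_radialTwistedLaplacian_le_add hf j s).trans ?_
  rw [mul_assoc, ← hQ, radialTwistedLaplacianConst]
  linarith

theorem abs_iteratedDeriv_iterate_radialTwistedLaplacian_le (hf : ContDiff ℝ ∞ f) (hR : 0 ≤ R)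
    (hfs : ∀ s, R < |s| → f s = 0) (hb : 1 ≤ b) {N : ℕ} (hN : (N : ℝ) ≤ b)
    (hfb : ∀ j, j ≤ N → ∀ s, |iteratedDeriv j f s| ≤ b ^ j) (m : ℕ) {j : ℕ}
    (hj : j + 2 * m ≤ N) (s : ℝ) :
    |iteratedDeriv j ((radialTwistedLaplacian n)^[m] f) s| ≤
      radialTwistedLaplacianConst n R ^ m * b ^ (j + 2 * m) := by
  induction m generalizing j s with
  | zero => simpa using hfb j hj s
  | succ m ih =>
    have h_supp : Set.EqOn ((radialTwistedLaplacian n)^[m] f) 0 {s | R < |s|} :=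
      eqOn_zero_iterate_radialTwistedLaplacian (isOpen_lt continuous_const continuous_abs)
        (fun s => hfs s) m
    rw [Function.iterate_succ_apply', pow_succ', mul_add_one]
    exact abs_iteratedDeriv_radialTwistedLaplacian_le (contDiff_iterate_radialTwistedLaplacian hf m)
      hR h_supp hb (pow_pos (radialTwistedLaplacianConst_pos n hR) m).le hN (fun j => ih) hj s

theorem abs_iterate_radialTwistedLaplacian_le (hf : ContDiff ℝ ∞ f) (hR : 0 ≤ R)
    (hfs : ∀ s, R < |s| → f s = 0) (hb : 1 ≤ b) {m : ℕ} (hm : (2 * m : ℝ) ≤ b)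
    (hfb : ∀ j, j ≤ 2 * m → ∀ s, |iteratedDeriv j f s| ≤ b ^ j) (s : ℝ) :
    |(radialTwistedLaplacian n)^[m] f s| ≤ (radialTwistedLaplacianConst n R * b ^ 2) ^ m := by
  have h := abs_iteratedDeriv_iterate_radialTwistedLaplacian_le (n := n) hf hR hfs hb
    (by exact_mod_cast hm) hfb m (zero_add (2 * m)).le s
  rwa [iteratedDeriv_zero, zero_add, pow_mul, ← mul_pow] at h

end IterateBounds

/-! ### Profiles adapted to a weight -/

section Weight

open scoped ContDiff

variable {η : ℝ → ℝ}

theorem IsInghamWeight.antitoneOn_mul_inv (hη : IsInghamWeight η) :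
    AntitoneOn (fun t => η t * t⁻¹) (Set.Ioi 0) := by
  intro s (hs : 0 < s) t (ht : 0 < t) hst
  exact mul_le_mul (hη.antitoneOn hs.le ht.le hst) (inv_anti₀ hs hst) (inv_pos.2 ht).le
    (hη.pos s hs.le).le

theorem IsInghamWeight.integrableOn_Ioi (hη : IsInghamWeight η) {δ : ℝ} (hδ : 0 < δ) :
    IntegrableOn (fun t => η t * t⁻¹) (Set.Ioi δ) := by
  have h_Icc : IntegrableOn (fun t => η t * t⁻¹) (Set.Icc δ 1) :=
    (hη.antitoneOn_mul_inv.mono fun t ht => hδ.trans_le ht.1).integrableOn_isCompact isCompact_Icc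
  refine (h_Icc.union hη.integrableOn).mono_set fun t ht => ?_
  rcases le_or_gt t 1 with h | h
  · exact Or.inl ⟨(Set.mem_Ioi.1 ht).le, h⟩
  · exact Or.inr h

theorem IsInghamWeight.dilate (hη : IsInghamWeight η) {δ : ℝ} (hδ : 0 < δ) :
    IsInghamWeight fun t => δ * η (δ * t) where
  pos t ht := mul_pos hδ (hη.pos _ (mul_nonneg hδ.le ht))
  antitoneOn s hs t ht hst := mul_le_mul_of_nonneg_left
    (hη.antitoneOn (mul_nonneg hδ.le hs) (mul_nonneg hδ.le ht)
      (mul_le_mul_of_nonneg_left hst hδ.le)) hδ.le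
  tendsto_zero := by
    simpa only [Function.comp_def, id_eq, mul_zero] using
      (hη.tendsto_zero.comp (tendsto_id.const_mul_atTop hδ)).const_mul δ
  integrableOn := by
    have h_dilate : IntegrableOn (fun t => η (δ * t) * (δ * t)⁻¹) (Set.Ioi 1) := by
      rw [integrableOn_Ioi_comp_mul_left_iff (fun t => η t * t⁻¹) 1 hδ, mul_one]
      exact hη.integrableOn_Ioi hδ
    refine (h_dilate.const_mul (δ ^ 2)).congr (ae_of_all _ fun t => ?_)
    simp only [mul_inv]
    field_simp

theorem IsInghamWeight.summable_two_pow (hη : IsInghamWeight η) :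
    Summable fun q : ℕ => η (2 ^ q) := by
  have h_nonneg (t : ℝ) (ht : 0 ≤ t) : 0 ≤ η t * t⁻¹ :=
    mul_nonneg (hη.pos t ht).le (inv_nonneg.2 ht)
  have h_sum : Summable fun i : ℕ => η i * (i : ℝ)⁻¹ :=
    AntitoneOn.summable_of_integrableOn_Ioi (N := 1)
      (hη.antitoneOn_mul_inv.mono fun t ht => one_pos.trans_le (by simpa using ht))
      (by simpa only [Nat.cast_one] using hη.integrableOn)
      fun t ht => h_nonneg t ((Nat.cast_nonneg 1).trans (Set.mem_Ioi.1 ht).le)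
  refine ((summable_condensed_iff_of_nonneg (fun i => h_nonneg i i.cast_nonneg)
    fun i j hi hij => hη.antitoneOn_mul_inv (Set.mem_Ioi.2 (Nat.cast_pos.2 hi))
      (Set.mem_Ioi.2 (Nat.cast_pos.2 (hi.trans_le hij))) (Nat.cast_le.2 hij)).2 h_sum).congr
    fun q => ?_
  push_cast
  field_simp

/-- The number of times the twisted Laplacian is applied at frequencies `2 ^ q ≤ t < 2 ^ (q + 1)`:
the first term produces the factor `e ^ (-t η(t))`, the second one absorbs `t ^ n`. -/
noncomputable def dyadicOrder (n : ℕ) (η : ℝ → ℝ) (q : ℕ) : ℕ :=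
  ⌈2 ^ q * η (2 ^ q)⌉₊ + n * q

theorem IsInghamWeight.summable_dyadicOrder_div (hη : IsInghamWeight η) (n : ℕ) :
    Summable fun q : ℕ => (dyadicOrder n η q : ℝ) / 2 ^ q := by
  have h_geom : Summable fun q : ℕ => (q : ℝ) ^ 1 * (1 / 2) ^ q :=
    summable_pow_mul_geometric_of_norm_lt_one 1 (by norm_num)
  refine Summable.of_nonneg_of_le (fun q => by positivity) (fun q => ?_)
    (hη.summable_two_pow.add (summable_geometric_two.add (h_geom.mul_left (n : ℝ))))
  have h_pos : (0 : ℝ) < 2 ^ q := by positivity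
  have h_ceil : (⌈(2 : ℝ) ^ q * η (2 ^ q)⌉₊ : ℝ) ≤ 2 ^ q * η (2 ^ q) + 1 :=
    (Nat.ceil_lt_add_one (mul_nonneg h_pos.le (hη.pos _ h_pos.le).le)).le
  calc (dyadicOrder n η q : ℝ) / 2 ^ q
      = (⌈2 ^ q * η (2 ^ q)⌉₊ + n * q) / 2 ^ q := by
        rw [dyadicOrder, Nat.cast_add, Nat.cast_mul]
    _ ≤ (2 ^ q * η (2 ^ q) + 1 + n * q) / 2 ^ q := by gcongr
    _ = η (2 ^ q) + ((1 / 2) ^ q + n * ((q : ℝ) ^ 1 * (1 / 2) ^ q)) := by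
        rw [div_pow, one_pow]
        field_simp
        ring

theorem exists_tsum_scale_le {m : ℕ → ℕ} (hm : Summable fun q => (m q : ℝ) / 2 ^ q) {κ r : ℝ}
    (hκ : 0 < κ) (hr : 0 < r) :
    ∃ q₀, (Summable fun p => ((2 * m (p + q₀) : ℕ) : ℝ) * (2 / (κ * 2 ^ (p + q₀)))) ∧
      ∑' p, ((2 * m (p + q₀) : ℕ) : ℝ) * (2 / (κ * 2 ^ (p + q₀))) ≤ r ∧
      ∀ q, q₀ ≤ q → 1 ≤ κ * 2 ^ q ∧ (2 * m q : ℝ) ≤ κ * 2 ^ q := by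
  have h_scale : Summable fun q => ((2 * m q : ℕ) : ℝ) * (2 / (κ * 2 ^ q)) := by
    refine (hm.mul_left (4 / κ)).congr fun q => ?_
    push_cast
    field_simp
    ring
  have h_large : Tendsto (fun q : ℕ => κ * 2 ^ q) atTop atTop :=
    (tendsto_pow_atTop_atTop_of_one_lt one_lt_two).const_mul_atTop hκ
  have h_order : ∀ᶠ q in atTop, (2 * m q : ℝ) ≤ κ * 2 ^ q := by
    filter_upwards [hm.tendsto_atTop_zero.eventually_le_const (half_pos hκ)] with q hq
    rw [div_le_iff₀ (by positivity)] at hq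
    linarith
  have h_tail := tendsto_sum_nat_add fun q => ((2 * m q : ℕ) : ℝ) * (2 / (κ * 2 ^ q))
  obtain ⟨q₀, h_tail_le, h_q₀⟩ := ((h_tail.eventually_le_const hr).and
    (eventually_forall_ge_atTop.2 ((h_large.eventually_ge_atTop 1).and h_order))).exists
  exact ⟨q₀, (summable_nat_add_iff q₀).2 h_scale, h_tail_le, h_q₀⟩

theorem exists_contDiff_abs_iterate_radialTwistedLaplacian_le (n : ℕ) {m : ℕ → ℕ}
    (hm : Summable fun q => (m q : ℝ) / 2 ^ q) {R ε : ℝ} (hR : 0 < R) (hε : 0 < ε) :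
    ∃ ψ : ℝ → ℝ, ContDiff ℝ ∞ ψ ∧ (∀ x, 0 ≤ ψ x) ∧ ψ 0 = 1 ∧ (∀ x, R < |x| → ψ x = 0) ∧
      (∀ x, ψ x ≤ 1) ∧
      ∀ᶠ q in atTop, ∀ s, |(radialTwistedLaplacian n)^[m q] ψ s| ≤ (ε * 4 ^ q) ^ m q := by
  have hA := radialTwistedLaplacianConst_pos n hR.le
  set A := radialTwistedLaplacianConst n R
  set κ : ℝ := √(ε / A)
  have hκ : 0 < κ := Real.sqrt_pos.2 (div_pos hε hA)
  have h_base (q : ℕ) : A * (κ * 2 ^ q) ^ 2 = ε * 4 ^ q := by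
    rw [mul_pow, Real.sq_sqrt (div_pos hε hA).le, ← pow_mul, mul_comm q, pow_mul,
      ← mul_assoc, mul_div_cancel₀ _ hA.ne']
    norm_num
  obtain ⟨q₀, h_summable, h_tsum, h_q₀⟩ := exists_tsum_scale_le hm hκ (div_pos hR three_pos)
  obtain ⟨ψ, hψ, hψ_nonneg, hψ_zero, hψ_supp, hψ_bound⟩ :=
    exists_contDiff_abs_iteratedDeriv_le (div_pos hR three_pos) (fun p => by positivity)
      h_summable h_tsum
  rw [mul_div_cancel₀ _ three_ne_zero] at hψ_supp
  simp only [div_div_cancel₀ (two_ne_zero' ℝ)] at hψ_bound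
  refine ⟨ψ, hψ, hψ_nonneg, hψ_zero, hψ_supp, fun x => (le_abs_self _).trans ?_, ?_⟩
  · simpa only [iteratedDeriv_zero, pow_zero] using hψ_bound 0 0 (Nat.zero_le _) x
  · filter_upwards [eventually_ge_atTop q₀] with q hq s
    obtain ⟨p, rfl⟩ := Nat.exists_eq_add_of_le' hq
    rw [← h_base]
    exact abs_iterate_radialTwistedLaplacian_le hψ hR.le hψ_supp (h_q₀ _ hq).1 (h_q₀ _ hq).2
      (hψ_bound p) s

theorem IsInghamWeight.mul_le_mul_of_le (hη : IsInghamWeight η) {s t T : ℝ} (hs : 0 ≤ s)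
    (hst : s ≤ t) (htT : t ≤ T) : t * η t ≤ T * η s :=
  mul_le_mul htT (hη.antitoneOn hs (hs.trans hst) hst) (hη.pos t (hs.trans hst)).le
    ((hs.trans hst).trans htT)

theorem IsInghamWeight.pow_le_mul_exp_neg (hη : IsInghamWeight η) (n : ℕ) {t T : ℝ} (ht : 0 ≤ t)
    (htT : t ≤ T) : t ^ n ≤ T ^ n * Real.exp (T * η 0) * Real.exp (-(t * η t)) := by
  rw [mul_assoc, ← Real.exp_add]
  refine (pow_le_pow_left₀ ht htT n).trans
    (le_mul_of_one_le_right (pow_nonneg (ht.trans htT) n) ?_)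
  exact Real.one_le_exp (by linarith [hη.mul_le_mul_of_le le_rfl ht htT])

theorem IsInghamWeight.exp_neg_two_mul_pow_dyadicOrder_le (hη : IsInghamWeight η) (n : ℕ) {q : ℕ}
    {t : ℝ} (hqt : 2 ^ q ≤ t) (htq : t < 2 ^ (q + 1)) :
    (Real.exp (-2) * 4 ^ q) ^ dyadicOrder n η q / (t ^ 2) ^ dyadicOrder n η q * t ^ n ≤
      2 ^ n * Real.exp (-(t * η t)) := by
  set m := dyadicOrder n η q with hm_def
  have ht : 0 < t := lt_of_lt_of_le (by positivity) hqt
  have h_four : (4 : ℝ) ^ q / t ^ 2 ≤ 1 := by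
    rw [div_le_one (by positivity)]
    calc (4 : ℝ) ^ q = (2 ^ q) ^ 2 := by rw [← pow_mul, mul_comm, pow_mul]; norm_num
      _ ≤ t ^ 2 := by gcongr
  have hm : t * η t + n * q ≤ 2 * m := by
    have h_ceil : (2 : ℝ) ^ q * η (2 ^ q) ≤ ⌈2 ^ q * η (2 ^ q)⌉₊ := Nat.le_ceil _
    have h_weight := hη.mul_le_mul_of_le (by positivity) hqt htq.le
    rw [pow_succ'] at h_weight
    rw [hm_def, dyadicOrder, Nat.cast_add, Nat.cast_mul]
    nlinarith [mul_nonneg (Nat.cast_nonneg (α := ℝ) n) q.cast_nonneg]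
  have h_pow : t ^ n ≤ 2 ^ n * Real.exp (n * q) :=
    calc t ^ n ≤ (2 ^ (q + 1)) ^ n := by gcongr
      _ = 2 ^ n * 2 ^ (n * q) := by rw [← pow_mul, ← pow_add]; congr 1; ring
      _ ≤ 2 ^ n * Real.exp 1 ^ (n * q) := by
          gcongr
          linarith [Real.add_one_le_exp (1 : ℝ)]
      _ = 2 ^ n * Real.exp (n * q) := by rw [← Real.exp_nat_mul, Nat.cast_mul, mul_one]
  calc (Real.exp (-2) * 4 ^ q) ^ m / (t ^ 2) ^ m * t ^ n
      = Real.exp (-(2 * m)) * (4 ^ q / t ^ 2) ^ m * t ^ n := by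
        rw [← div_pow, mul_div_assoc, mul_pow, ← Real.exp_nat_mul]
        ring_nf
    _ ≤ Real.exp (-(t * η t + n * q)) * 1 * (2 ^ n * Real.exp (n * q)) := by
        gcongr
        exact pow_le_one₀ (by positivity) h_four
    _ = 2 ^ n * Real.exp (-(t * η t)) := by
        rw [mul_one, mul_left_comm, ← Real.exp_add]
        ring_nf

theorem IsInghamWeight.exists_pow_le_mul_exp_neg (hη : IsInghamWeight η) (n q₀ : ℕ) :
    ∃ C : ℝ, 0 < C ∧ ∀ t, 1 ≤ t → t ^ n ≤ C * Real.exp (-(t * η t)) ∨ ∃ q, q₀ ≤ q ∧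
      (Real.exp (-2) * 4 ^ q) ^ dyadicOrder n η q / (t ^ 2) ^ dyadicOrder n η q * t ^ n ≤
        C * Real.exp (-(t * η t)) := by
  set C_low : ℝ := (2 ^ q₀) ^ n * Real.exp (2 ^ q₀ * η 0)
  refine ⟨C_low + 2 ^ n, by positivity, fun t ht => ?_⟩
  rw [add_mul]
  rcases le_or_gt t (2 ^ q₀) with h_low | h_high
  · exact .inl ((hη.pow_le_mul_exp_neg n (zero_le_one.trans ht) h_low).trans
      (le_add_of_nonneg_right (by positivity)))
  · obtain ⟨q, hqt, htq⟩ := exists_nat_pow_near ht one_lt_two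
    have hq : q₀ ≤ q :=
      Nat.lt_succ_iff.1 ((pow_lt_pow_iff_right₀ one_lt_two).1 (h_high.trans htq))
    exact .inr ⟨q, hq, (hη.exp_neg_two_mul_pow_dyadicOrder_le n hqt htq).trans
      (le_add_of_nonneg_left (by positivity))⟩

end Weight

/-! ### Normalized kernels -/

section Kernel

open scoped ContDiff

variable {n : ℕ} {η : ℝ → ℝ}

theorem exists_eLpNorm_twistedConv_sqRadial_laguerreFun_le (hn : 1 ≤ n) {R : ℝ} (hR : 0 < R) :
    ∃ D : ℝ, 0 < D ∧ ∀ ⦃g : ℝ → ℝ⦄, ContDiff ℝ ∞ g → (∀ s, R < s → g s = 0) → ∀ ⦃m : ℕ⦄ ⦃B : ℝ⦄,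
      (∀ s, |(radialTwistedLaplacian n)^[m] g s| ≤ B) → ∀ k : ℕ,
        eLpNorm (twistedConv (sqRadial n g) (laguerreFun n k)) 2 volume ≤ ENNReal.ofReal
          (D * (B / (√(2 * (k : ℝ) + n) ^ 2) ^ m * √(2 * (k : ℝ) + n) ^ n)) := by
  obtain ⟨L, hL, hLk⟩ := exists_eLpNorm_laguerreFun_le hn
  have hV : 0 < volume.real (Metric.closedBall (0 : EuclideanSpace ℂ (Fin n)) √R) :=
    ENNReal.toReal_pos (Metric.measure_closedBall_pos _ _ (Real.sqrt_pos.2 hR)).ne'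
      measure_closedBall_lt_top.ne
  refine ⟨_, mul_pos hV hL, fun g hg hgs m B hgB k => ?_⟩
  have hB : 0 ≤ B := (abs_nonneg _).trans (hgB 0)
  refine (eLpNorm_twistedConv_sqRadial_laguerreFun_le hn hg hgs hgB k).trans
    ((mul_le_mul_right (hLk k) _).trans_eq ?_)
  rw [← ENNReal.ofReal_mul (by positivity), Real.sq_sqrt (by positivity)]
  congr 1
  ring

theorem IsInghamWeight.exists_profile (hη : IsInghamWeight η) (hn : 1 ≤ n) {R : ℝ} (hR : 0 < R) :
    ∃ ψ : ℝ → ℝ, Continuous ψ ∧ (∀ s, 0 ≤ ψ s) ∧ ψ 0 = 1 ∧ (∀ s, R < s → ψ s = 0) ∧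
      ∃ C : ℝ, 0 < C ∧ ∀ k : ℕ,
        eLpNorm (twistedConv (sqRadial n ψ) (laguerreFun n k)) 2 volume ≤ ENNReal.ofReal
          (C * Real.exp (-(√(2 * (k : ℝ) + n) * η √(2 * (k : ℝ) + n)))) := by
  obtain ⟨ψ, hψ, hψ_nonneg, hψ_zero, hψ_supp, hψ_le, hψ_bound⟩ :=
    exists_contDiff_abs_iterate_radialTwistedLaplacian_le n (hη.summable_dyadicOrder_div n) hR
      (Real.exp_pos (-2))
  obtain ⟨q₀, hq₀⟩ := eventually_atTop.1 hψ_bound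
  obtain ⟨D, hD, hψ_decay⟩ := exists_eLpNorm_twistedConv_sqRadial_laguerreFun_le hn hR
  have hψ_supp' (s : ℝ) (hs : R < s) : ψ s = 0 := hψ_supp s (lt_abs.2 (.inl hs))
  obtain ⟨C, hC, hC_bound⟩ := hη.exists_pow_le_mul_exp_neg n q₀
  refine ⟨ψ, hψ.continuous, hψ_nonneg, hψ_zero, hψ_supp', D * C, mul_pos hD hC, fun k => ?_⟩
  have ht : 1 ≤ √(2 * (k : ℝ) + n) :=
    Real.one_le_sqrt.2 (by exact_mod_cast hn.trans (Nat.le_add_left n (2 * k)))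
  rw [mul_assoc]
  rcases hC_bound _ ht with h_low | ⟨q, hq, h_high⟩
  · have h_one (s : ℝ) : |(radialTwistedLaplacian n)^[0] ψ s| ≤ 1 :=
      (abs_of_nonneg (hψ_nonneg s)).trans_le (hψ_le s)
    refine (hψ_decay hψ hψ_supp' h_one k).trans (ENNReal.ofReal_le_ofReal ?_)
    rw [pow_zero, div_one, one_mul]
    gcongr
  · refine (hψ_decay hψ hψ_supp' (hq₀ q hq) k).trans (ENNReal.ofReal_le_ofReal ?_)
    gcongr

theorem sqRadial_const_mul (c : ℝ) (f : ℝ → ℝ) :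
    sqRadial n (fun s => c * f s) = (c : ℂ) • sqRadial n f := by
  funext z
  simp only [sqRadial, Pi.smul_apply, smul_eq_mul, Complex.ofReal_mul]

theorem twistedConv_const_smul_left (f g : EuclideanSpace ℂ (Fin n) → ℂ) (c : ℂ) :
    twistedConv (c • f) g = c • twistedConv f g := by
  funext z
  simp only [twistedConv_apply, Pi.smul_apply, smul_eq_mul, ← integral_const_mul, mul_assoc]

theorem integral_sqRadial_pos {f : ℝ → ℝ} (hf : Continuous f) (hf_nonneg : ∀ s, 0 ≤ f s)
    (hf_zero : f 0 ≠ 0) {R : ℝ} (hfs : ∀ s, R < s → f s = 0) :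
    0 < ∫ w : EuclideanSpace ℂ (Fin n), f (‖w‖ ^ 2) := by
  have h_supp : HasCompactSupport fun w : EuclideanSpace ℂ (Fin n) => f (‖w‖ ^ 2) := by
    simpa only [Function.comp_def, sqRadial, Complex.ofReal_re] using
      (hasCompactSupport_sqRadial (n := n) hfs).comp_left Complex.zero_re
  refine Continuous.integral_pos_of_hasCompactSupport_nonneg_nonzero (by fun_prop) h_supp
    (fun w => hf_nonneg _) (x := 0) ?_
  rwa [norm_zero, zero_pow two_ne_zero]

theorem integrable_sqRadial {f : ℝ → ℝ} (hf : Continuous f) {R : ℝ} (hfs : ∀ s, R < s → f s = 0) :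
    Integrable (sqRadial n f) :=
  (continuous_sqRadial hf).integrable_of_hasCompactSupport (hasCompactSupport_sqRadial hfs)

theorem eLpNorm_one_sqRadial_of_nonneg {f : ℝ → ℝ} (hf : Integrable (sqRadial n f))
    (hf_nonneg : ∀ s, 0 ≤ f s) :
    eLpNorm (sqRadial n f) 1 volume =
      ENNReal.ofReal (∫ w : EuclideanSpace ℂ (Fin n), f (‖w‖ ^ 2)) := by
  rw [eLpNorm_one_eq_lintegral_enorm, ← ofReal_integral_norm_eq_lintegral_enorm hf]
  simp only [sqRadial, Complex.norm_real, Real.norm_of_nonneg (hf_nonneg _)]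

theorem IsInghamWeight.exists_normalized (hη : IsInghamWeight η) (hn : 1 ≤ n) {δ : ℝ}
    (hδ : 0 < δ) :
    ∃ g : EuclideanSpace ℂ (Fin n) → ℂ, Integrable g ∧ IsRadial g ∧
      tsupport g ⊆ Metric.ball 0 δ ∧ ∫ w, g w = 1 ∧ eLpNorm g 1 volume = 1 ∧
      ∃ C : ℝ, 0 < C ∧ ∀ k : ℕ,
        eLpNorm (twistedConv g (laguerreFun n k)) 2 volume ≤ ENNReal.ofReal
          (C * Real.exp (-(√(2 * (k : ℝ) + n) * η √(2 * (k : ℝ) + n)))) := by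
  obtain ⟨ψ, hψ, hψ_nonneg, hψ_zero, hψ_supp, C, hC, hψ_decay⟩ :=
    hη.exists_profile hn (R := (δ / 2) ^ 2) (by positivity)
  have hI : 0 < ∫ w : EuclideanSpace ℂ (Fin n), ψ (‖w‖ ^ 2) :=
    integral_sqRadial_pos hψ hψ_nonneg (hψ_zero ▸ one_ne_zero) hψ_supp
  set c : ℝ := (∫ w : EuclideanSpace ℂ (Fin n), ψ (‖w‖ ^ 2))⁻¹
  have hc : 0 < c := inv_pos.2 hI
  have h_integral : ∫ w : EuclideanSpace ℂ (Fin n), c * ψ (‖w‖ ^ 2) = 1 := by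
    rw [integral_const_mul, inv_mul_cancel₀ hI.ne']
  have h_supp (s : ℝ) (hs : (δ / 2) ^ 2 < s) : c * ψ s = 0 := by rw [hψ_supp s hs, mul_zero]
  have h_integrable : Integrable (sqRadial n fun s => c * ψ s) :=
    integrable_sqRadial (by fun_prop) h_supp
  refine ⟨sqRadial n fun s => c * ψ s, h_integrable, isRadial_sqRadial _, ?_, ?_, ?_, c * C,
    mul_pos hc hC, fun k => ?_⟩
  · refine (tsupport_sqRadial_subset h_supp).trans (Metric.closedBall_subset_ball ?_)
    rw [Real.sqrt_sq (half_pos hδ).le]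
    exact half_lt_self hδ
  · simp only [sqRadial]
    rw [integral_complex_ofReal, h_integral, Complex.ofReal_one]
  · rw [eLpNorm_one_sqRadial_of_nonneg h_integrable fun s => mul_nonneg hc.le (hψ_nonneg s),
      h_integral, ENNReal.ofReal_one]
  · rw [sqRadial_const_mul, twistedConv_const_smul_left, eLpNorm_const_smul, mul_assoc,
      ENNReal.ofReal_mul hc.le, ← ofReal_norm, Complex.norm_real, Real.norm_of_nonneg hc.le]
    gcongr
    exact hψ_decay k

theorem tendsto_support_smallSets_of_tsupport_subset_ball {X M : Type*} [PseudoMetricSpace X]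
    [Zero M] {x : X} {g : ℝ → X → M} (hg : ∀ δ, 0 < δ → tsupport (g δ) ⊆ Metric.ball x δ) :
    Tendsto (fun δ => Function.support (g δ)) (𝓝[>] 0) (𝓝 x).smallSets := by
  refine tendsto_smallSets_iff.2 fun U hU => ?_
  obtain ⟨ε, hε, hεU⟩ := Metric.mem_nhds_iff.1 hU
  filter_upwards [Ioo_mem_nhdsGT hε] with δ hδ
  exact (subset_tsupport _).trans
    ((hg δ hδ.1).trans ((Metric.ball_subset_ball hδ.2.le).trans hεU))

end Kernel

theorem mainTheorem7 (n : ℕ) (hn : 1 ≤ n) (θ : ℝ → ℝ) (hθ : IsInghamWeight θ) :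
    ∃ g : ℝ → EuclideanSpace ℂ (Fin n) → ℂ,
      (∀ δ : ℝ, 0 < δ →
        Integrable (g δ) ∧ IsRadial (g δ) ∧ tsupport (g δ) ⊆ Metric.ball 0 δ) ∧
      (∀ f : EuclideanSpace ℂ (Fin n) → ℂ, Integrable f →
        Tendsto (fun δ : ℝ => eLpNorm (twistedConv f (g δ) - f) 1 volume) (𝓝[>] 0) (𝓝 0)) ∧
      ∀ δ : ℝ, 0 < δ → ∃ θδ : ℝ → ℝ,
        (∀ t : ℝ, 0 ≤ t → θδ t = δ * θ (δ * t)) ∧ IsInghamWeight θδ ∧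
        ∃ C : ℝ, 0 < C ∧ ∀ k : ℕ,
          eLpNorm (twistedConv (g δ) (laguerreFun n k)) 2 volume ≤
            ENNReal.ofReal
              (C * Real.exp (-(√(2 * (k : ℝ) + n) * θδ (√(2 * (k : ℝ) + n))))) := by
  choose! g hg_int hg_rad hg_supp hg_integral hg_norm hg_decay using
    fun (δ : ℝ) (hδ : 0 < δ) => (hθ.dilate hδ).exists_normalized hn hδ
  refine ⟨g, fun δ hδ => ⟨hg_int δ hδ, hg_rad δ hδ, hg_supp δ hδ⟩, fun f hf => ?_,
    fun δ hδ => ⟨fun t => δ * θ (δ * t), fun t _ => rfl, hθ.dilate hδ, hg_decay δ hδ⟩⟩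
  have h_pos : ∀ᶠ δ : ℝ in 𝓝[>] 0, 0 < δ := eventually_mem_nhdsWithin
  exact tendsto_eLpNorm_twistedConv_sub_self ENNReal.one_ne_top
    (tendsto_support_smallSets_of_tsupport_subset_ball hg_supp)
    (h_pos.mono fun δ hδ => (hg_norm δ hδ).le) (h_pos.mono hg_integral) hf
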